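/- Let $N_t\ge 1$ be an integer and $\rho>0$. For every $L\ge N_t$ let $h_1,\dots,h_L$ (the virtual channel of length $L$, single receive antenna) be i.i.d. circularly symmetric complex Gaussian variables with mean $0$ and variance $1$. For $m=1,\dots,M$, $M=L-N_t+1$, let $H_m=[h_m,\dots,h_{m+N_t-1}]$ be the channel observed when the array of $N_t$ antennas is placed at the $m$-th window of adjacent columns, let $z_m=\|H_m\|^2$, let $m^*\in\arg\max_m z_m$ (ties broken arbitrarily), and let the mutual information be $\mathcal I=\log_2(1+\rho\|H_{m^*}\|^2)$. Let $\delta=0$ if $N_t=1$ and $\delta=1$ if $N_t\ge2$, let $\gamma$ be Euler's constant, and put $$\xi_L=\ln\frac{L-N_t+1}{(N_t-1)!}+\delta\,(N_t-1)\ln(N_t-1),\qquad \phi_L=\delta\,\frac{N_t-1}{\xi_L}\Big[1+(N_t+\xi_L-1)\ln\frac{\xi_L}{N_t-1}\Big],$$ (terms with the factor $\delta=0$ being $0$), $$\beta_L=\frac{(\xi_L+\phi_L)^2+(N_t-1)(\xi_L+\phi_L)}{(\xi_L+\phi_L)^2-(N_t-1)(N_t-2)},\qquad \Theta_L=\xi_L+\phi_L+\gamma\beta_L,\qquad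 \mu_L=\log_2(1+\rho\,\Theta_L),$$ and let $(\sigma_L)$ be any real sequence with $$\sigma_L=\frac{\beta_L\,\rho\,\log_2 e}{1+\rho\,\Theta_L}+\mathcal O\Big(\frac1{\ln^2L}\Big).$$ Let $\mathrm{Gumbel}[\mu;\sigma]$ denote the law on $\mathbb R$ with distribution function $x\mapsto e^{-e^{-(x-\mu)/\sigma}}$. Then: 1. For every $L\ge N_t$, each $z_m$ has the $\mathrm{Gamma}(N_t,1)$ law, the sequence $z_1,\dots,z_M$ is stationary (joint laws of consecutive terms are shift invariant), and it is $N_t$-dependent (groups of terms whose indices are at distance at least $N_t$ from each other are independent). 2. As $L\to\infty$, $\big(\max_m z_m-(\xi_L+\phi_L)\big)/\beta_L$ converges in distribution to $\mathrm{Gumbel}[0;1]$. 3. $\mathcal I$ is asymptotically distributed as $\mathrm{Gumbel}[\mu_L-\gamma\sigma_L;\sigma_L]$: $\sigma_L>0$ for all large $L$; $\big(\mathcal I-(\mu_L-\gamma\sigma_L)\big)/\sigma_L$ converges in distribution to $\mathrm{Gumbel}[0;1]$; and the supremum over $\mathbb R$ of the absolute difference between the distribution functions of $\mathcal I$ and of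 $\mathrm{Gumbel}[\mu_L-\gamma\sigma_L;\sigma_L]$ tends to $0$. 4. (Hardening) $\mu_L\sim\log_2\log_2L$ and $\mu_L-\gamma\sigma_L\sim\log_2\log_2 L$ (ratios tending to $1$), $\sigma_L\to0$, and $\mathcal I-\mu_L\to0$ in probability. -/

import Mathlib

open MeasureTheory ProbabilityTheory Filter Topology Asymptotics
open scoped ENNReal NNReal

noncomputable section

/-! Gumbel laws -/

/-- The distribution function `z ↦ exp (-exp (-z))` of the standard (type-one) Gumbel law. -/
def stdGumbelCDF : StieltjesFunction ℝ where
  toFun z := Real.exp (-Real.exp (-z))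
  mono' := by
    intro a b hab
    simp only [Real.exp_le_exp, neg_le_neg_iff]
    exact hab
  right_continuous' := fun x => by
    have : Continuous fun z : ℝ => Real.exp (-Real.exp (-z)) := by fun_prop
    exact this.continuousWithinAt

/-- The Gumbel law with location `μ` and scale `σ`: the law of `μ + σ z`, where `z` is standard
Gumbel. For `0 < σ` its distribution function is `x ↦ exp (-exp (-(x - μ) / σ))`, see
`cdf_gumbelMeasure`. -/
def gumbelMeasure (μ σ : ℝ) : Measure ℝ :=
  stdGumbelCDF.measure.map fun z => μ + σ * z

theorem stdGumbelCDF_atBot : Tendsto stdGumbelCDF atBot (𝓝 0) := by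
  have h1 : Tendsto (fun z : ℝ => Real.exp (-z)) atBot atTop :=
    Real.tendsto_exp_atTop.comp tendsto_neg_atBot_atTop
  exact Real.tendsto_exp_atBot.comp (tendsto_neg_atTop_atBot.comp h1)

theorem stdGumbelCDF_atTop : Tendsto stdGumbelCDF atTop (𝓝 1) := by
  have h1 : Tendsto (fun z : ℝ => Real.exp (-z)) atTop (𝓝 0) := Real.tendsto_exp_neg_atTop_nhds_zero
  have h2 : Tendsto (fun z : ℝ => Real.exp (-Real.exp (-z))) atTop (𝓝 (Real.exp (-0))) :=
    (Real.continuous_exp.tendsto _).comp h1.neg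
  rw [neg_zero, Real.exp_zero] at h2
  exact h2

instance isProbabilityMeasure_stdGumbel : IsProbabilityMeasure stdGumbelCDF.measure :=
  stdGumbelCDF.isProbabilityMeasure stdGumbelCDF_atBot stdGumbelCDF_atTop

instance isProbabilityMeasure_gumbelMeasure (μ σ : ℝ) :
    IsProbabilityMeasure (gumbelMeasure μ σ) :=
  Measure.isProbabilityMeasure_map (by fun_prop)

theorem cdf_gumbelMeasure (μ : ℝ) {σ : ℝ} (hσ : 0 < σ) (x : ℝ) :
    cdf (gumbelMeasure μ σ) x = Real.exp (-Real.exp (-(x - μ) / σ)) := by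
  have hpre : (fun z : ℝ => μ + σ * z) ⁻¹' Set.Iic x = Set.Iic ((x - μ) / σ) := by
    ext z
    simp only [Set.mem_preimage, Set.mem_Iic, le_div_iff₀ hσ]
    constructor <;> intro h <;> linarith
  rw [cdf_eq_real, measureReal_def, gumbelMeasure,
    Measure.map_apply (by fun_prop) measurableSet_Iic, hpre,
    stdGumbelCDF.measure_Iic stdGumbelCDF_atBot, sub_zero,
    ENNReal.toReal_ofReal (by exact (Real.exp_pos _).le), neg_div]
  rfl

/-! The array and its channel -/

/-- The circularly symmetric complex Gaussian law of mean `0` and variance `1`: independent real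
and imaginary parts, each a centred real Gaussian of variance `1 / 2`. -/
def stdComplexGaussian : Measure ℂ :=
  ((gaussianReal 0 (1 / 2)).prod (gaussianReal 0 (1 / 2))).map Complex.measurableEquivRealProd.symm

/-- The channel observed at the `m`-th location (counted from `0`) of an array of `N` antennas: the
row vector of the `N` adjacent entries `m, …, m + N - 1` of the virtual channel `g` of length `L`.
There are `L - N + 1` locations. -/
def observedChannel {N L : ℕ} (hNL : N ≤ L) (g : Fin L → ℂ) (m : Fin (L - N + 1)) :
    EuclideanSpace ℂ (Fin N) :=
  WithLp.toLp 2 fun j => g ⟨m.1 + j.1, by have := m.2; have := j.2; omega⟩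

/-- The energy `‖H_m‖²` of the channel observed at the `m`-th location. -/
def windowEnergy {N L : ℕ} (hNL : N ≤ L) (g : Fin L → ℂ) (m : Fin (L - N + 1)) : ℝ :=
  ‖observedChannel hNL g m‖ ^ 2

/-- The largest window energy `max_m ‖H_m‖²`. -/
def maxWindowEnergy {N L : ℕ} (hNL : N ≤ L) (g : Fin L → ℂ) : ℝ :=
  Finset.univ.sup' Finset.univ_nonempty (windowEnergy hNL g)

/-- The `m`-th location maximizes the window energy, `m ∈ arg max_k ‖H_k‖²`. -/
def IsStrongestWindow {N L : ℕ} (hNL : N ≤ L) (g : Fin L → ℂ) (m : Fin (L - N + 1)) : Prop :=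
  ∀ k, windowEnergy hNL g k ≤ windowEnergy hNL g m

/-- The mutual information `log₂ (1 + ρ ‖H_m‖²)`, in bits, with the array at location `m`. -/
def mutualInformation (ρ : ℝ) {N L : ℕ} (hNL : N ≤ L) (g : Fin L → ℂ) (m : Fin (L - N + 1)) : ℝ :=
  Real.logb 2 (1 + ρ * ‖observedChannel hNL g m‖ ^ 2)

/-! Finite sequences of random variables -/

/-- A finite sequence of random variables is stationary: the joint law of consecutive terms is
invariant under shifts within the index range. -/
def IsStationarySeq {Ω : Type*} [MeasurableSpace Ω] (P : Measure Ω) {M : ℕ}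
    (X : Fin M → Ω → ℝ) : Prop :=
  ∀ (k s : ℕ) (hks : k + s ≤ M),
    P.map (fun ω (i : Fin k) => X ⟨i.1 + s, by have := i.2; omega⟩ ω) =
      P.map (fun ω (i : Fin k) => X ⟨i.1, by have := i.2; omega⟩ ω)

/-- A finite sequence of random variables is `K`-dependent: two groups of terms are independent as
soon as any index of the first is at distance at least `K` from any index of the second. For
one-term groups: `X i` and `X j` are independent whenever `K ≤ |i - j|`. -/
def IsMDependentSeq {Ω : Type*} [MeasurableSpace Ω] (P : Measure Ω) (K : ℕ) {M : ℕ}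
    (X : Fin M → Ω → ℝ) : Prop :=
  ∀ A B : Finset (Fin M), (∀ i ∈ A, ∀ j ∈ B, (K : ℤ) ≤ |(i.1 : ℤ) - (j.1 : ℤ)|) →
    IndepFun (fun ω (i : A) => X i.1 ω) (fun ω (j : B) => X j.1 ω) P

/-! The normalizing sequences, for `N` antennas and a virtual channel of length `L` -/

/-- `δ = 0` for one antenna and `δ = 1` otherwise. -/
def deltaInd (N : ℕ) : ℝ := if N = 1 then 0 else 1

def xiSeq (N L : ℕ) : ℝ :=
  Real.log (((L : ℝ) - N + 1) / ((N - 1).factorial : ℝ))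
    + deltaInd N * ((N : ℝ) - 1) * Real.log ((N : ℝ) - 1)

def phiSeq (N L : ℕ) : ℝ :=
  deltaInd N * (((N : ℝ) - 1) / xiSeq N L)
    * (1 + ((N : ℝ) + xiSeq N L - 1) * Real.log (xiSeq N L / ((N : ℝ) - 1)))

def betaSeq (N L : ℕ) : ℝ :=
  ((xiSeq N L + phiSeq N L) ^ 2 + ((N : ℝ) - 1) * (xiSeq N L + phiSeq N L))
    / ((xiSeq N L + phiSeq N L) ^ 2 - ((N : ℝ) - 1) * ((N : ℝ) - 2))

def thetaSeq (N L : ℕ) : ℝ :=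
  xiSeq N L + phiSeq N L + Real.eulerMascheroniConstant * betaSeq N L

/-- `μ_L = log₂ (1 + ρ Θ_L)`. -/
def muSeq (ρ : ℝ) (N L : ℕ) : ℝ := Real.logb 2 (1 + ρ * thetaSeq N L)

/-- The leading term `β_L ρ log₂ e / (1 + ρ Θ_L)` of the scale `σ_L`. -/
def sigmaMain (ρ : ℝ) (N L : ℕ) : ℝ :=
  betaSeq N L * ρ * Real.logb 2 (Real.exp 1) / (1 + ρ * thetaSeq N L)

end

/-! Distribution functions and weak convergence -/

/-! Everything reduces to `P(max_m z_m ≤ u_L) → exp (-exp (-x))` whenever `u_L = ξ_L + φ_L + x +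
o(1)`. The maximum stays below `u` exactly when no window exceeds `u`, and two facts make these `M`
exceedances behave as if independent. Windows at distance at least `N` share no column. Distinct
overlapping windows share at most `N - 1` columns, and averaging their two energies shows that they
exceed `u` jointly with probability `O(u^(N-2) e^(-u))`, one power of `u` below the single tail `p ~
u^(N-1) e^(-u) / (N-1)!`. Exceedances therefore do not cluster, and a recursion over the windows
gives `(1 - p)^M` up to `O(M (p² + q))`, `q` being the joint bound
(`abs_measureReal_forall_notMem_sub_pow_le`, `measureReal_lt_sum_inter_lt_sum_le`).

The choice of `φ_L` gives `ξ_L + φ_L = ln (M/(N-1)!) + (N-1) ln ξ_L + o(1)`, the classical Gamma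
centring. At the levels above this yields `M p → e^(-x)` and `M (p² + q) → 0`
(`tendsto_mul_gammaTail`, `tendsto_extremal_error`). Since `β_L → 1`, dividing by `β_L` does not
change the limit.

The mutual information is an increasing function of the maximal energy, so its level `μ_L - γ σ_L +
σ_L x` pulls back to an energy level. Linearising the exponential shows that this level is again
`ξ_L + φ_L + x + o(1)` (`tendsto_energyLevel_sub_centring`). Pólya's theorem makes the convergence
uniform, and `σ_L → 0` gives hardening. -/

theorem isPiSystem_range_Ioc : IsPiSystem (Set.range fun p : ℝ × ℝ => Set.Ioc p.1 p.2) := by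
  rintro _ ⟨p, rfl⟩ _ ⟨q, rfl⟩ _
  exact ⟨(p.1 ⊔ q.1, p.2 ⊓ q.2), Set.Ioc_inter_Ioc.symm⟩

theorem measureReal_Ioc_eq_cdf_sub (μ : Measure ℝ) [IsProbabilityMeasure μ] {a b : ℝ}
    (hab : a ≤ b) : μ.real (Set.Ioc a b) = cdf μ b - cdf μ a := by
  rw [cdf_eq_real, cdf_eq_real, ← Set.Iic_union_Ioc_eq_Iic hab,
    measureReal_union (Set.Iic_disjoint_Ioc le_rfl) measurableSet_Ioc]
  ring

/-- Pointwise convergence of distribution functions implies weak convergence. -/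
theorem probabilityMeasure_tendsto_of_tendsto_cdf {ι : Type*} {l : Filter ι}
    [l.IsCountablyGenerated] {μ : ι → ProbabilityMeasure ℝ} {ν : ProbabilityMeasure ℝ}
    (h : ∀ x, Tendsto (fun i => cdf (μ i : Measure ℝ) x) l (𝓝 (cdf (ν : Measure ℝ) x))) :
    Tendsto μ l (𝓝 ν) := by
  -- Half-open intervals form a π-system containing arbitrarily small neighbourhoods of every point,
  -- and their masses are differences of the distribution functions.
  refine isPiSystem_range_Ioc.tendsto_probabilityMeasure_of_tendsto_of_mem ?_ ?_ ?_
  · rintro _ ⟨p, rfl⟩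
    exact measurableSet_Ioc
  · intro u hu x hx
    obtain ⟨ε, hε, hball⟩ := Metric.isOpen_iff.1 hu x hx
    refine ⟨Set.Ioc (x - ε / 2) (x + ε / 2), ⟨(x - ε / 2, x + ε / 2), rfl⟩,
      Ioc_mem_nhds (by linarith) (by linarith), fun y hy => hball ?_⟩
    rw [Metric.mem_ball, Real.dist_eq, abs_lt]
    constructor <;> linarith [hy.1, hy.2]
  · rintro _ ⟨⟨a, b⟩, rfl⟩
    rcases le_total b a with hab | hab
    · simpa [Set.Ioc_eq_empty_of_le hab] using tendsto_const_nhds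
    · rw [← NNReal.tendsto_coe]
      have key (κ : ProbabilityMeasure ℝ) :
          ((κ (Set.Ioc a b) : ℝ≥0) : ℝ) = cdf (κ : Measure ℝ) b - cdf (κ : Measure ℝ) a := by
        rw [← measureReal_Ioc_eq_cdf_sub _ hab]; rfl
      simp only [key]
      exact (h b).sub (h a)

theorem cdf_map_apply {Ω : Type*} [MeasurableSpace Ω] (P : Measure Ω) [IsProbabilityMeasure P]
    {X : Ω → ℝ} (hX : Measurable X) (x : ℝ) : cdf (P.map X) x = P.real {ω | X ω ≤ x} := by
  have := Measure.isProbabilityMeasure_map (μ := P) hX.aemeasurable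
  rw [cdf_eq_real, map_measureReal_apply hX measurableSet_Iic]
  rfl

theorem cdf_gumbelMeasure_zero_one (x : ℝ) :
    cdf (gumbelMeasure 0 1) x = Real.exp (-Real.exp (-x)) := by
  simp [cdf_gumbelMeasure 0 one_pos]

/-- Convergence in distribution to the standard Gumbel law, from distribution functions. -/
theorem tendstoInDistribution_gumbel {ι : Type*} {Ω : ι → Type*} [∀ i, MeasurableSpace (Ω i)]
    {P : (i : ι) → Measure (Ω i)} [∀ i, IsProbabilityMeasure (P i)] {l : Filter ι}
    [l.IsCountablyGenerated] {X : (i : ι) → Ω i → ℝ} (hX : ∀ i, Measurable (X i))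
    (h : ∀ x, Tendsto (fun i => (P i).real {ω | X i ω ≤ x}) l (𝓝 (Real.exp (-Real.exp (-x))))) :
    TendstoInDistribution X l (fun z : ℝ => z) P (gumbelMeasure 0 1) where
  forall_aemeasurable i := (hX i).aemeasurable
  aemeasurable_limit := aemeasurable_id
  tendsto := by
    refine probabilityMeasure_tendsto_of_tendsto_cdf fun x => ?_
    have hid : (gumbelMeasure 0 1).map (fun z : ℝ => z) = gumbelMeasure 0 1 := Measure.map_id
    simp only [ProbabilityMeasure.coe_mk, hid, cdf_gumbelMeasure_zero_one,
      cdf_map_apply (P _) (hX _)]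
    exact h x

/-- **Pólya's theorem**: pointwise convergence of monotone functions to a strictly increasing
distribution function with range `(0, 1)` is uniform. -/
theorem eventually_forall_abs_sub_le_of_monotone {ι : Type*} {l : Filter ι} {f : ι → ℝ → ℝ}
    {G : ℝ → ℝ} (hf : ∀ i, Monotone (f i)) (hf0 : ∀ i x, 0 ≤ f i x) (hf1 : ∀ i x, f i x ≤ 1)
    (hG : StrictMono G) (hG01 : ∀ x, G x ∈ Set.Ioo (0 : ℝ) 1)
    (hGsurj : ∀ p ∈ Set.Ioo (0 : ℝ) 1, ∃ x, G x = p)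
    (h : ∀ x, Tendsto (fun i => f i x) l (𝓝 (G x))) {ε : ℝ} (hε : 0 < ε) :
    ∀ᶠ i in l, ∀ x, |f i x - G x| ≤ ε := by
  -- Only the quantiles of `G` at the levels `k / K` are controlled, each within `1 / K`.
  -- Monotonicity between neighbouring quantiles costs another `1 / K`, whence `2 / K < ε`.
  obtain ⟨K, hK⟩ := exists_nat_gt (2 / ε)
  have hK0 : (0 : ℝ) < K := lt_trans (by positivity) hK
  have hKε : 2 / (K : ℝ) < ε := by
    rw [div_lt_iff₀ hε] at hK; rw [div_lt_iff₀ hK0]; linarith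
  have h2K : 2 / (K : ℝ) = 1 / K + 1 / K := by ring
  have hev : ∀ᶠ i in l, ∀ k ∈ Finset.range K, ∀ x, G x = (k : ℝ) / K →
      |f i x - G x| < 1 / K := by
    rw [Filter.eventually_all_finset]
    intro k _
    by_cases hx : ∃ x, G x = (k : ℝ) / K
    · obtain ⟨x, hx⟩ := hx
      have := (Metric.tendsto_nhds.1 (h x)) (1 / K) (by positivity)
      filter_upwards [this] with i hi y hy
      rw [hG.injective (hy.trans hx.symm)]
      simpa [Real.dist_eq] using hi
    · exact Eventually.of_forall fun i x hx' => absurd ⟨x, hx'⟩ hx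
  filter_upwards [hev] with i hi x
  obtain ⟨hx0, hx1⟩ := hG01 x
  set k := ⌊(K : ℝ) * G x⌋₊ with hk
  have hk1 : (k : ℝ) ≤ K * G x := Nat.floor_le (by positivity)
  have hk2 : (K : ℝ) * G x < k + 1 := Nat.lt_floor_add_one _
  have hlow : (k : ℝ) / K ≤ G x := by rw [div_le_iff₀ hK0]; linarith
  have hupp : G x < ((k + 1 : ℕ) : ℝ) / K := by rw [lt_div_iff₀ hK0]; push_cast; linarith
  have hkK : k < K := by
    have : (k : ℝ) < K := by nlinarith
    exact_mod_cast this
  have hsucc : ((k + 1 : ℕ) : ℝ) / K = (k : ℝ) / K + 1 / K := by push_cast; ring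
  rw [abs_le]
  constructor
  -- The levels `0` and `1` have no quantile; in the two extreme cells the bounds `0 ≤ f` and `f ≤
  -- 1` replace it.
  · rcases Nat.eq_zero_or_pos k with h0 | h0
    · rw [hsucc, h0] at hupp
      have := hf0 i x
      have h1K : 0 < 1 / (K : ℝ) := by positivity
      simp only [Nat.cast_zero, zero_div] at hupp
      linarith
    · obtain ⟨y, hy⟩ := hGsurj ((k : ℝ) / K) ⟨by positivity, hlow.trans_lt hx1⟩
      have hyx : y ≤ x := hG.le_iff_le.1 (hy ▸ hlow)
      have := abs_lt.1 (hi k (Finset.mem_range.2 hkK) y hy)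
      have := hf i hyx
      linarith
  · rcases (Nat.succ_le_of_lt hkK).eq_or_lt with h0 | h0
    · have h0' : ((k + 1 : ℕ) : ℝ) / K = 1 := by
        rw [show k + 1 = K from h0]; exact div_self hK0.ne'
      have := hf1 i x
      linarith [show (0 : ℝ) < 1 / K by positivity]
    · obtain ⟨y, hy⟩ := hGsurj (((k + 1 : ℕ) : ℝ) / K) ⟨by positivity, by
        rw [div_lt_one hK0]; exact_mod_cast h0⟩
      have hyx : x ≤ y := hG.le_iff_le.1 (hy ▸ hupp.le)
      have := abs_lt.1 (hi (k + 1) (Finset.mem_range.2 h0) y hy)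
      have := hf i hyx
      linarith

theorem strictMono_stdGumbelCDF : StrictMono fun x : ℝ => Real.exp (-Real.exp (-x)) :=
  fun _ _ hab => by simpa using hab

theorem stdGumbelCDF_mem_Ioo (x : ℝ) : Real.exp (-Real.exp (-x)) ∈ Set.Ioo (0 : ℝ) 1 :=
  ⟨Real.exp_pos _, by simpa using Real.exp_pos _⟩

theorem exists_stdGumbelCDF_eq {p : ℝ} (hp : p ∈ Set.Ioo (0 : ℝ) 1) :
    ∃ x : ℝ, Real.exp (-Real.exp (-x)) = p := by
  refine ⟨-Real.log (-Real.log p), ?_⟩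
  rw [neg_neg, Real.exp_log (by linarith [Real.log_neg hp.1 hp.2]), neg_neg, Real.exp_log hp.1]

/-- The distribution functions of random variables whose affine normalizations converge in
distribution to the standard Gumbel law are uniformly close to Gumbel distribution functions. -/
theorem tendsto_iSup_abs_cdf_sub_gumbel {ι : Type*} {Ω : ι → Type*} [∀ i, MeasurableSpace (Ω i)]
    {P : (i : ι) → Measure (Ω i)} [∀ i, IsProbabilityMeasure (P i)] {l : Filter ι}
    {X : (i : ι) → Ω i → ℝ} (hX : ∀ i, Measurable (X i)) {a s : ι → ℝ} (hs : ∀ᶠ i in l, 0 < s i)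
    (h : ∀ x, Tendsto (fun i => (P i).real {ω | (X i ω - a i) / s i ≤ x}) l
      (𝓝 (Real.exp (-Real.exp (-x))))) :
    Tendsto (fun i => ⨆ x : ℝ, |cdf ((P i).map (X i)) x - cdf (gumbelMeasure (a i) (s i)) x|) l
      (𝓝 0) := by
  rw [Metric.tendsto_nhds]
  intro ε hε
  have := eventually_forall_abs_sub_le_of_monotone
    (f := fun i x => (P i).real {ω | (X i ω - a i) / s i ≤ x})
    (fun i x y hxy => measureReal_mono (fun ω (hω : _ ≤ x) => hω.trans hxy))
    (fun i x => measureReal_nonneg) (fun i x => measureReal_le_one)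
    strictMono_stdGumbelCDF stdGumbelCDF_mem_Ioo (fun p hp => exists_stdGumbelCDF_eq hp) h
    (half_pos hε)
  filter_upwards [this, hs] with i hi hsi
  have hnn : 0 ≤ ⨆ x : ℝ, |cdf ((P i).map (X i)) x - cdf (gumbelMeasure (a i) (s i)) x| :=
    Real.iSup_nonneg fun _ => abs_nonneg _
  rw [Real.dist_eq, sub_zero, abs_of_nonneg hnn]
  refine (ciSup_le fun x => ?_).trans_lt (half_lt_self hε)
  -- Uniformity in the argument allows the point of evaluation to move with `i`.
  have hx := hi ((x - a i) / s i)
  rw [cdf_gumbelMeasure _ hsi, cdf_map_apply (P i) (hX i), neg_div]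
  simpa only [div_le_div_iff_of_pos_right hsi, sub_le_sub_iff_right] using hx

/-! Maxima of locally dependent events -/

/-- Probability that none of the events `A 0, …, A (M - 1)` of common probability `p` occurs, when
`A m` is independent of the non-occurrence of all events of index at most `m - K`, and two events
at distance less than `K` occur jointly with probability at most `q`. -/
theorem abs_measureReal_forall_notMem_sub_pow_le {Ω : Type*} [MeasurableSpace Ω] (P : Measure Ω)
    [IsProbabilityMeasure P] {A : ℕ → Set Ω} {M K : ℕ} {p q : ℝ} (hq : 0 ≤ q) (hK : 1 ≤ K)
    (hA : ∀ m < M, MeasurableSet (A m)) (hp : ∀ m < M, P.real (A m) = p)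
    (hind : ∀ m < M, P.real (A m ∩ {ω | ∀ i, i + K ≤ m → ω ∉ A i}) =
      p * P.real {ω | ∀ i, i + K ≤ m → ω ∉ A i})
    (hjoint : ∀ m < M, ∀ i < m, m < i + K → P.real (A i ∩ A m) ≤ q) :
    |P.real {ω | ∀ i < M, ω ∉ A i} - (1 - p) ^ M| ≤ M * (K * (p ^ 2 + q)) := by
  rcases Nat.eq_zero_or_pos M with rfl | hM
  · simp
  have hp0 : 0 ≤ p := hp 0 hM ▸ measureReal_nonneg
  have hp1 : p ≤ 1 := hp 0 hM ▸ measureReal_le_one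
  have hmeas (m : ℕ) (hm : m ≤ M) : MeasurableSet {ω | ∀ i < m, ω ∉ A i} := by
    have : {ω | ∀ i < m, ω ∉ A i} = ⋂ i ∈ Finset.range m, (A i)ᶜ := by ext; simp
    rw [this]
    exact Finset.measurableSet_biInter _ fun i hi =>
      (hA i ((Finset.mem_range.1 hi).trans_le hm)).compl
  -- Write `P(B_{m+1}) = P(B) - P(A m ∩ B)` and replace `B` by the event `C` that ignores the last
  -- indices and is independent of `A m`. This costs at most `K q` in `P(A m ∩ B)` and `K p` in
  -- `P(B)`, so one step multiplies by `1 - p` up to `K (p² + q)`.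
  have key : ∀ m ≤ M, |P.real {ω | ∀ i < m, ω ∉ A i} - (1 - p) ^ m| ≤ m * (K * (p ^ 2 + q)) := by
    intro m
    induction m with
    | zero => intro _; simp
    | succ m ih =>
      intro hm
      have hmM : m < M := hm
      set B := {ω | ∀ i < m, ω ∉ A i} with hB
      set C := {ω | ∀ i, i + K ≤ m → ω ∉ A i} with hC
      set J := (Finset.range m).filter fun i => m < i + K with hJ
      have hJcard : (J.card : ℝ) ≤ K := by
        have : J ⊆ Finset.Ico (m + 1 - K) m := by
          intro i hi
          simp only [hJ, Finset.mem_filter, Finset.mem_range] at hi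
          simp only [Finset.mem_Ico]; omega
        have h2 := Finset.card_le_card this
        rw [Nat.card_Ico] at h2
        exact_mod_cast h2.trans (by omega)
      have hBC : B ⊆ C := fun ω hω i (hi : i + K ≤ m) => hω i (by omega)
      have hCB : C ⊆ B ∪ ⋃ i ∈ J, A i := by
        intro ω hω
        by_cases hωB : ω ∈ B
        · exact Or.inl hωB
        · right
          simp only [hB, Set.mem_ofPred_eq, not_forall, not_not] at hωB
          obtain ⟨i, him, hi⟩ := hωB
          simp only [Set.mem_iUnion]
          refine ⟨i, ?_, hi⟩
          simp only [hJ, Finset.mem_filter, Finset.mem_range]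
          refine ⟨him, ?_⟩
          by_contra hcon
          exact hω i (by omega) hi
      have hACB : A m ∩ C ⊆ (A m ∩ B) ∪ ⋃ i ∈ J, (A i ∩ A m) := by
        rintro ω ⟨h1, h2⟩
        rcases hCB h2 with h3 | h3
        · exact Or.inl ⟨h1, h3⟩
        · right
          simp only [Set.mem_iUnion] at h3 ⊢
          obtain ⟨i, hi, h4⟩ := h3
          exact ⟨i, hi, h4, h1⟩
      have e1 : P.real C ≤ P.real B + K * p := by
        refine (measureReal_mono hCB).trans ((measureReal_union_le _ _).trans ?_)
        gcongr
        refine (measureReal_biUnion_finset_le _ _).trans ?_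
        rw [Finset.sum_congr rfl (g := fun _ => p) fun i hi => hp i (by
          simp only [hJ, Finset.mem_filter, Finset.mem_range] at hi; omega),
          Finset.sum_const, nsmul_eq_mul]
        gcongr
      have e2 : P.real (A m ∩ C) ≤ P.real (A m ∩ B) + K * q := by
        refine (measureReal_mono hACB).trans ((measureReal_union_le _ _).trans ?_)
        gcongr
        refine (measureReal_biUnion_finset_le _ _).trans ?_
        refine (Finset.sum_le_card_nsmul J _ q fun i hi => ?_).trans ?_
        · simp only [hJ, Finset.mem_filter, Finset.mem_range] at hi
          exact hjoint m hmM i hi.1 hi.2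
        · rw [nsmul_eq_mul]; gcongr
      have e3 : P.real (A m ∩ B) ≤ P.real (A m ∩ C) :=
        measureReal_mono (Set.inter_subset_inter_right _ hBC)
      have e4 : P.real B ≤ P.real C := measureReal_mono hBC
      have e5 := hind m hmM
      have e6 : P.real {ω | ∀ i < m + 1, ω ∉ A i} = P.real B - P.real (A m ∩ B) := by
        have : {ω | ∀ i < m + 1, ω ∉ A i} = B \ A m := by
          ext ω
          simp only [hB, Set.mem_ofPred_eq, Set.mem_sdiff, Nat.lt_succ_iff_lt_or_eq]
          constructor
          · intro h; exact ⟨fun i hi => h i (Or.inl hi), h m (Or.inr rfl)⟩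
          · rintro ⟨h1, h2⟩ i (hi | rfl)
            exacts [h1 i hi, h2]
        rw [this, ← measureReal_inter_add_sdiff (s := B) (hA m hmM), Set.inter_comm B]
        ring
      have ih' := ih hmM.le
      rw [e6]
      have e7 : |P.real B - P.real (A m ∩ B) - (1 - p) * P.real B| ≤ K * (p ^ 2 + q) := by
        have hKq : 0 ≤ K * q := by positivity
        have hKp : 0 ≤ (K : ℝ) * p ^ 2 := by positivity
        have : p * P.real C ≤ p * P.real B + K * p ^ 2 := by nlinarith
        have : p * P.real B ≤ p * P.real C := by gcongr
        rw [abs_le]; constructor <;> linarith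
      -- The factor `1 - p` lies in `[0, 1]`, so earlier errors are not amplified and the total is
      -- linear in `m`.
      have e8 : |(1 - p) * (P.real B - (1 - p) ^ m)| ≤ m * (K * (p ^ 2 + q)) := by
        rw [abs_mul, abs_of_nonneg (by linarith : 0 ≤ 1 - p)]
        refine (mul_le_of_le_one_left (abs_nonneg _) (by linarith)).trans ih'
      calc |P.real B - P.real (A m ∩ B) - (1 - p) ^ (m + 1)|
          = |(P.real B - P.real (A m ∩ B) - (1 - p) * P.real B)
              + (1 - p) * (P.real B - (1 - p) ^ m)| := by congr 1; ring
        _ ≤ _ := abs_add_le _ _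
        _ ≤ K * (p ^ 2 + q) + m * (K * (p ^ 2 + q)) := add_le_add e7 e8
        _ = _ := by push_cast; ring
  exact key M le_rfl

/-! Gamma laws -/

/-- The tail of the Gamma law of shape `k` and rate `1` at `x ≥ 0`. -/
noncomputable def gammaTail (k : ℕ) (x : ℝ) : ℝ :=
  Real.exp (-x) * ∑ i ∈ Finset.range k, x ^ i / (i.factorial : ℝ)

/-- The derivative telescopes: differentiating `x^(i+1)/(i+1)!` cancels the term `-x^i/i!` coming
from the exponential, leaving only the top one. -/
theorem hasDerivAt_gammaTail_succ (k : ℕ) (x : ℝ) :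
    HasDerivAt (gammaTail (k + 1)) (-(Real.exp (-x) * (x ^ k / (k.factorial : ℝ)))) x := by
  induction k with
  | zero =>
    have h1 : HasDerivAt (fun y : ℝ => Real.exp (-y)) (Real.exp (-x) * (-1)) x :=
      (hasDerivAt_neg x).exp
    convert! h1 using 1
    · ext y; simp [gammaTail]
    · simp
  | succ k ih =>
    have h1 : HasDerivAt (fun y : ℝ => Real.exp (-y)) (Real.exp (-x) * (-1)) x :=
      (hasDerivAt_neg x).exp
    have h2 : HasDerivAt (fun y : ℝ => y ^ (k + 1) / ((k + 1).factorial : ℝ))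
        (x ^ k / (k.factorial : ℝ)) x := by
      convert! (hasDerivAt_pow (k + 1) x).div_const ((k + 1).factorial : ℝ) using 1
      rw [Nat.factorial_succ]
      push_cast
      have : (k.factorial : ℝ) ≠ 0 := by positivity
      have : (k : ℝ) + 1 ≠ 0 := by positivity
      field_simp
    convert! ih.add (h1.mul h2) using 1
    · ext y
      simp only [gammaTail, Finset.sum_range_succ _ (k + 1), Pi.add_apply, Pi.mul_apply]
      ring
    · ring

theorem tendsto_gammaTail_atTop (k : ℕ) : Tendsto (gammaTail k) atTop (𝓝 0) := by
  have : Tendsto (fun x : ℝ => ∑ i ∈ Finset.range k, x ^ i * Real.exp (-x) / (i.factorial : ℝ))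
      atTop (𝓝 (∑ i ∈ Finset.range k, 0 / (i.factorial : ℝ))) :=
    tendsto_finsetSum _ fun i _ =>
      (Real.tendsto_pow_mul_exp_neg_atTop_nhds_zero i).div_const _
  simp only [zero_div, Finset.sum_const_zero] at this
  refine this.congr fun x => ?_
  rw [gammaTail, Finset.mul_sum]
  exact Finset.sum_congr rfl fun i _ => by ring

theorem gammaMeasure_real_Ioi {k : ℕ} (hk : 1 ≤ k) {x : ℝ} (hx : 0 ≤ x) :
    (gammaMeasure k 1).real (Set.Ioi x) = gammaTail k x := by
  obtain ⟨n, rfl⟩ : ∃ n, k = n + 1 := ⟨k - 1, by omega⟩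
  have hpdf (y : ℝ) (hy : y ∈ Set.Ioi x) :
      gammaPDFReal ((n + 1 : ℕ) : ℝ) 1 y = Real.exp (-y) * (y ^ n / (n.factorial : ℝ)) := by
    have hy0 : 0 ≤ y := hx.trans (le_of_lt hy)
    rw [gammaPDFReal, if_pos hy0]
    push_cast
    rw [Real.one_rpow, Real.Gamma_nat_eq_factorial, add_sub_cancel_right, Real.rpow_natCast,
      one_mul]
    ring
  have hderiv (y : ℝ) (_ : y ∈ Set.Ici x) :
      HasDerivAt (fun z => -gammaTail (n + 1) z) (Real.exp (-y) * (y ^ n / (n.factorial : ℝ))) y := by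
    convert! (hasDerivAt_gammaTail_succ n y).neg using 1
    ring
  have hpos (y : ℝ) (hy : y ∈ Set.Ioi x) : 0 ≤ Real.exp (-y) * (y ^ n / (n.factorial : ℝ)) := by
    have : 0 ≤ y := hx.trans (le_of_lt hy)
    positivity
  have hlim : Tendsto (fun z => -gammaTail (n + 1) z) atTop (𝓝 (-0)) :=
    (tendsto_gammaTail_atTop _).neg
  rw [measureReal_def, gammaMeasure, withDensity_apply _ measurableSet_Ioi]
  simp only [gammaPDF]
  rw [← integral_eq_lintegral_of_nonneg_ae, setIntegral_congr_fun measurableSet_Ioi hpdf,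
    integral_Ioi_of_hasDerivAt_of_nonneg' hderiv hpos hlim]
  · simp
  · exact ae_of_all _ fun y => gammaPDFReal_nonneg (by positivity) one_pos y
  · exact (measurable_gammaPDFReal _ _).aestronglyMeasurable

/-- The polynomial is bounded at `u` while the exponential stays at `x`, so that for `x = u - t` the
bound depends on `t` only through `e^t`. -/
theorem gammaTail_le {k : ℕ} {x u : ℝ} (hx : 0 ≤ x) (hxu : x ≤ u) (hu : 1 ≤ u) :
    gammaTail k x ≤ k * u ^ (k - 1) * Real.exp (-x) := by
  rw [gammaTail, mul_comm]
  gcongr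
  refine (Finset.sum_le_card_nsmul _ _ (u ^ (k - 1)) fun i hi => ?_).trans_eq ?_
  · have hik : i ≤ k - 1 := by have := Finset.mem_range.1 hi; omega
    have h1 : (1 : ℝ) ≤ (i.factorial : ℝ) := by exact_mod_cast i.factorial_pos
    calc x ^ i / (i.factorial : ℝ) ≤ x ^ i := div_le_self (by positivity) h1
      _ ≤ u ^ i := by gcongr
      _ ≤ u ^ (k - 1) := pow_le_pow_right₀ hu hik
  · simp

/-- Upper bound of the tail of the Gamma law that also covers negative arguments. -/
theorem gammaMeasure_real_Ioi_le {k : ℕ} (hk : 1 ≤ k) {x u : ℝ} (hxu : x ≤ u) (hu : 1 ≤ u) :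
    (gammaMeasure k 1).real (Set.Ioi x) ≤ k * u ^ (k - 1) * Real.exp (-x) := by
  rcases le_total 0 x with hx | hx
  · rw [gammaMeasure_real_Ioi hk hx]
    exact gammaTail_le hx hxu hu
  · have := isProbabilityMeasure_gammaMeasure (a := k) (r := 1) (by exact_mod_cast hk) one_pos
    have h1 : (1 : ℝ) ≤ k := by exact_mod_cast hk
    have h2 : (1 : ℝ) ≤ u ^ (k - 1) := one_le_pow₀ hu
    have h3 : (1 : ℝ) ≤ Real.exp (-x) := Real.one_le_exp (by linarith)
    calc _ ≤ (1 : ℝ) := measureReal_le_one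
      _ ≤ _ := one_le_mul_of_one_le_of_one_le (one_le_mul_of_one_le_of_one_le h1 h2) h3

/-- The value `0` for `t ≥ 1` is the default of a divergent integral. It is recorded because laws
are later identified by equality of `mgf` on all of `ℝ`. -/
theorem mgf_id_gammaMeasure {k : ℕ} (hk : 1 ≤ k) (t : ℝ) :
    mgf id (gammaMeasure k 1) t = if t < 1 then (1 - t)⁻¹ ^ k else 0 := by
  have hk0 : (0 : ℝ) < k := by exact_mod_cast hk
  have hΓ : Real.Gamma k ≠ 0 := (Real.Gamma_pos_of_pos hk0).ne'
  have h1 : mgf id (gammaMeasure k 1) t =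
      (Real.Gamma k)⁻¹ * ∫ x in Set.Ioi (0 : ℝ), x ^ ((k : ℝ) - 1) * Real.exp (-((1 - t) * x)) := by
    rw [mgf, gammaMeasure, integral_withDensity_eq_integral_toReal_smul
      (f := gammaPDF k 1) (measurable_gammaPDFReal _ _).ennreal_ofReal
      (ae_of_all _ fun _ => ENNReal.ofReal_lt_top),
      ← setIntegral_eq_integral_of_forall_compl_eq_zero (s := Set.Ici 0),
      integral_Ici_eq_integral_Ioi, ← integral_const_mul]
    · refine setIntegral_congr_fun measurableSet_Ioi fun x (hx : 0 < x) => ?_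
      have hpdf : (gammaPDF k 1 x).toReal = gammaPDFReal k 1 x :=
        ENNReal.toReal_ofReal (gammaPDFReal_nonneg hk0 one_pos x)
      simp only [hpdf, gammaPDFReal, if_pos hx.le, Real.one_rpow, one_div, one_mul, smul_eq_mul, id]
      rw [mul_assoc, mul_assoc, ← Real.exp_add]
      congr 3
      ring
    · intro x hx
      rw [gammaPDF_of_neg (not_le.1 hx)]
      simp
  rw [h1]
  split_ifs with ht
  · rw [Real.integral_rpow_mul_exp_neg_mul_Ioi hk0 (by linarith)]
    rw [Real.rpow_natCast, one_div]
    field_simp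
  -- For `t ≥ 1` the integrand dominates `x^(k-1)`, which is not integrable on the half-line.
  · rw [integral_undef, mul_zero]
    intro hint
    refine not_integrableOn_Ioi_rpow ((k : ℝ) - 1) (Integrable.mono' hint ?_ ?_)
    · exact (measurable_id.pow_const _).aestronglyMeasurable
    · filter_upwards [ae_restrict_mem measurableSet_Ioi] with x hx
      have hx0 : 0 < x := hx
      rw [Real.norm_of_nonneg (by positivity)]
      refine le_mul_of_one_le_right (by positivity) (Real.one_le_exp ?_)
      nlinarith

/-- Variance `1 / 2` gives the density `π^(-1/2) e^(-x²)`, so the integrand is a Gaussian of rate `1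
- t`. For `t ≥ 1` both sides take the default value `0`. -/
theorem integral_exp_mul_sq_gaussianReal (t : ℝ) :
    ∫ x, Real.exp (t * x ^ 2) ∂(gaussianReal 0 (1 / 2)) = √(1 - t)⁻¹ := by
  rw [integral_gaussianReal_eq_integral_smul (by norm_num)]
  have (x : ℝ) : gaussianPDFReal 0 (1 / 2) x • Real.exp (t * x ^ 2) =
      (√Real.pi)⁻¹ * Real.exp (-(1 - t) * x ^ 2) := by
    rw [gaussianPDFReal, smul_eq_mul, mul_assoc, ← Real.exp_add]
    have h2 : 2 * Real.pi * ((1 / 2 : ℝ≥0) : ℝ) = Real.pi := by push_cast; ring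
    have h3 : -(x - 0) ^ 2 / (2 * ((1 / 2 : ℝ≥0) : ℝ)) + t * x ^ 2 = -(1 - t) * x ^ 2 := by
      push_cast; ring
    rw [h2, h3]
  simp only [this]
  rw [integral_const_mul, integral_gaussian, Real.sqrt_div Real.pi_pos.le, Real.sqrt_inv]
  have : √Real.pi ≠ 0 := by positivity
  field_simp

theorem mgf_norm_sq_stdComplexGaussian (t : ℝ) :
    mgf (fun z : ℂ => ‖z‖ ^ 2) stdComplexGaussian t = if t < 1 then (1 - t)⁻¹ else 0 := by
  have h1 : mgf (fun z : ℂ => ‖z‖ ^ 2) stdComplexGaussian t = √(1 - t)⁻¹ * √(1 - t)⁻¹ := by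
    rw [mgf, stdComplexGaussian, integral_map_equiv, ← integral_exp_mul_sq_gaussianReal,
      ← integral_prod_mul]
    congr 1
    ext p
    rw [← Real.exp_add, ← mul_add, ← Complex.normSq_eq_norm_sq, Complex.normSq_apply]
    simp [sq]
  rw [h1]
  split_ifs with ht
  · exact Real.mul_self_sqrt (by rw [inv_nonneg]; linarith)
  · rw [Real.sqrt_eq_zero_of_nonpos (by rw [inv_nonpos]; linarith), mul_zero]

/-- A random variable whose moment generating function is that of the Gamma law of shape `k` has
this law. -/
theorem map_eq_gammaMeasure_of_mgf {Ω : Type*} [MeasurableSpace Ω] {P : Measure Ω}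
    [IsProbabilityMeasure P] {X : Ω → ℝ} (hX : Measurable X) {k : ℕ} (hk : 1 ≤ k)
    (h : ∀ t, mgf X P t = if t < 1 then (1 - t)⁻¹ ^ k else 0) :
    P.map X = gammaMeasure k 1 := by
  have := isProbabilityMeasure_gammaMeasure (a := k) (r := 1) (by exact_mod_cast hk) one_pos
  have hmgf : mgf X P = mgf id (gammaMeasure k 1) := by
    ext t; rw [h, mgf_id_gammaMeasure hk]
  have hmem : Set.Iio (1 : ℝ) ⊆ integrableExpSet X P := by
    intro t (ht : t < 1)
    rw [integrableExpSet, Set.mem_ofPred_eq, ← mgf_pos_iff, h, if_pos ht]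
    have : 0 < 1 - t := by linarith
    positivity
  -- Equality on the real line extends analytically to a vertical strip. As `0` is interior to the
  -- integrability set, the strip contains the imaginary axis, where the characteristic functions
  -- live.
  have heq := eqOn_complexMGF_of_mgf hmgf
  have hzero : (0 : ℝ) ∈ interior (integrableExpSet X P) :=
    interior_mono hmem (by simp)
  have := Measure.isProbabilityMeasure_map (μ := P) hX.aemeasurable
  refine Measure.ext_of_charFun (funext fun t => ?_)
  rw [← complexMGF_mul_I hX.aemeasurable, ← complexMGF_id_mul_I]
  exact heq (by simpa using hzero)

/-! Sums of independent exponential variables -/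

section ExponentialSums

variable {Ω : Type*} [MeasurableSpace Ω] {P : Measure Ω}

/-- Tail of the sum of a Gamma variable and an independent nonnegative variable with lighter
tail. -/
theorem measureReal_lt_add_le_of_gamma [IsProbabilityMeasure P] {S T : Ω → ℝ} (hS : Measurable S)
    (hT : Measurable T) (hST : IndepFun S T P) {k : ℕ} (hk : 1 ≤ k)
    (hSlaw : P.map S = gammaMeasure k 1) (hT0 : ∀ ω, 0 ≤ T ω)
    (hTint : Integrable (fun ω => Real.exp (T ω)) P) {u : ℝ} (hu : 1 ≤ u) :
    P.real {ω | u < S ω + T ω} ≤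
      k * u ^ (k - 1) * Real.exp (-u) * ∫ ω, Real.exp (T ω) ∂P := by
  have := isProbabilityMeasure_gammaMeasure (a := k) (r := 1) (by exact_mod_cast hk) one_pos
  have hset : MeasurableSet {p : ℝ × ℝ | u < p.1 + p.2} :=
    measurableSet_lt measurable_const (measurable_fst.add measurable_snd)
  have hu0 : (0 : ℝ) ≤ u := by linarith
  -- Condition on `T`. The argument `u - T` may be negative, hence the tail bound valid for all real
  -- arguments.
  have h1 : P {ω | u < S ω + T ω} = ∫⁻ ω, gammaMeasure k 1 (Set.Ioi (u - T ω)) ∂P := by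
    have : {ω | u < S ω + T ω} = (fun ω => (S ω, T ω)) ⁻¹' {p : ℝ × ℝ | u < p.1 + p.2} := rfl
    rw [this, ← Measure.map_apply (hS.prodMk hT) hset,
      (indepFun_iff_map_prod_eq_prod_map_map hS.aemeasurable hT.aemeasurable).1 hST, hSlaw,
      Measure.prod_apply_symm hset, lintegral_map (measurable_measure_prodMk_right hset) hT]
    refine lintegral_congr fun ω => congrArg _ ?_
    ext x
    simp [sub_lt_iff_lt_add]
  have h2 : P {ω | u < S ω + T ω} ≤
      ENNReal.ofReal (∫ ω, k * u ^ (k - 1) * Real.exp (-u) * Real.exp (T ω) ∂P) := by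
    rw [h1, ofReal_integral_eq_lintegral_ofReal (hTint.const_mul _)
      (ae_of_all _ fun ω => by positivity)]
    refine lintegral_mono fun ω => ?_
    rw [ENNReal.le_ofReal_iff_toReal_le (measure_ne_top _ _) (by positivity)]
    refine (gammaMeasure_real_Ioi_le hk (sub_le_self u (hT0 ω)) hu).trans_eq ?_
    rw [mul_assoc _ (Real.exp (-u)), ← Real.exp_add]
    congr 2
    ring
  rw [← integral_const_mul]
  exact ENNReal.toReal_le_of_le_ofReal (integral_nonneg fun ω => by positivity) h2

variable {ι : Type*} {E : ι → Ω → ℝ}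

/-- Nonemptiness matters for `t ≥ 1`: the empty product would be `1` instead of the default `0`. -/
theorem mgf_sum_exponential (hE : ∀ l, Measurable (E l)) (hind : iIndepFun E P)
    (hmgf : ∀ l t, mgf (E l) P t = if t < 1 then (1 - t)⁻¹ else 0) {s : Finset ι}
    (hs : s.Nonempty) (t : ℝ) :
    mgf (fun ω => ∑ l ∈ s, E l ω) P t = if t < 1 then (1 - t)⁻¹ ^ s.card else 0 := by
  have : (fun ω => ∑ l ∈ s, E l ω) = ∑ l ∈ s, E l := by ext; simp
  rw [this, hind.mgf_sum hE]
  simp only [hmgf, Finset.prod_const]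
  split_ifs
  · rfl
  · exact zero_pow hs.card_pos.ne'

theorem map_sum_exponential (hE : ∀ l, Measurable (E l)) (hind : iIndepFun E P)
    (hmgf : ∀ l t, mgf (E l) P t = if t < 1 then (1 - t)⁻¹ else 0) {s : Finset ι}
    (hs : s.Nonempty) : P.map (fun ω => ∑ l ∈ s, E l ω) = gammaMeasure s.card 1 :=
  have := hind.isProbabilityMeasure
  map_eq_gammaMeasure_of_mgf (Finset.measurable_sum _ fun l _ => hE l) hs.card_pos
    (mgf_sum_exponential hE hind hmgf hs)

/-- Two distinct overlapping sums of `N` independent exponential variables rarely exceed a high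
level simultaneously. -/
theorem measureReal_lt_sum_inter_lt_sum_le [DecidableEq ι] (hE : ∀ l, Measurable (E l))
    (hE0 : ∀ l ω, 0 ≤ E l ω) (hind : iIndepFun E P)
    (hmgf : ∀ l t, mgf (E l) P t = if t < 1 then (1 - t)⁻¹ else 0) {N : ℕ} {s₁ s₂ : Finset ι}
    (h₁ : s₁.card = N) (h₂ : s₂.card = N) (hne : s₁ ≠ s₂) (hinter : (s₁ ∩ s₂).Nonempty)
    {u : ℝ} (hu : 1 ≤ u) :
    P.real ({ω | u < ∑ l ∈ s₁, E l ω} ∩ {ω | u < ∑ l ∈ s₂, E l ω}) ≤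
      N * 4 ^ N * (u ^ (N - 2) * Real.exp (-u)) := by
  have := hind.isProbabilityMeasure
  set I := s₁ ∩ s₂ with hI
  set D := (s₁ \ s₂) ∪ (s₂ \ s₁) with hD
  have hID : Disjoint I D := by
    rw [Finset.disjoint_left]; intro x; simp only [hI, hD, Finset.mem_inter, Finset.mem_union,
      Finset.mem_sdiff]; tauto
  have hdisj : Disjoint (s₁ \ s₂) (s₂ \ s₁) := disjoint_sdiff_sdiff
  have hc1 : (s₁ \ s₂).card + I.card = N := h₁ ▸ Finset.card_sdiff_add_card_inter s₁ s₂
  have hc2 : (s₂ \ s₁).card + I.card = N := by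
    rw [hI, Finset.inter_comm]; exact h₂ ▸ Finset.card_sdiff_add_card_inter s₂ s₁
  have hDcard : D.card = (s₁ \ s₂).card + (s₂ \ s₁).card := Finset.card_union_of_disjoint hdisj
  have hsdiff : 0 < (s₁ \ s₂).card := by
    rw [Finset.card_pos, Finset.sdiff_nonempty]
    intro hsub
    exact hne (Finset.eq_of_subset_of_card_le hsub (by omega))
  have hIpos : 1 ≤ I.card := hinter.card_pos
  have hDne : D.Nonempty := Finset.card_pos.1 (by omega)
  set S : Ω → ℝ := fun ω => ∑ l ∈ I, E l ω with hSdef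
  -- Averaging the two inequalities gives `u < S + T`: shared columns keep weight `1`, the others
  -- get weight `1 / 2`. This weight makes `e^T` integrable, with a factor `(1 - 1/2)⁻¹ = 2` per
  -- column.
  set T : Ω → ℝ := fun ω => 1 / 2 * ∑ l ∈ D, E l ω with hTdef
  have hmeas (s : Finset ι) : Measurable fun ω => ∑ l ∈ s, E l ω :=
    Finset.measurable_sum _ fun l _ => hE l
  have hST : IndepFun S T P := by
    have h := hind.indepFun_finset I D hID hE
    have := h.comp (φ := fun x : I → ℝ => ∑ l, x l) (ψ := fun x : D → ℝ => 1 / 2 * ∑ l, x l)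
      (by fun_prop) (by fun_prop)
    convert! this using 1
    · ext ω; simp only [hSdef, Function.comp]; exact (Finset.sum_coe_sort I fun l => E l ω).symm
    · ext ω; simp only [hTdef, Function.comp]; rw [← Finset.sum_coe_sort D fun l => E l ω]
  have hTmgf : ∫ ω, Real.exp (T ω) ∂P = 2 ^ D.card := by
    have := mgf_sum_exponential hE hind hmgf hDne (1 / 2)
    rw [if_pos (by norm_num), mgf] at this
    rw [this]; norm_num
  have hTint : Integrable (fun ω => Real.exp (T ω)) P := by
    by_contra hcon
    rw [integral_undef hcon] at hTmgf
    exact (pow_pos (two_pos : (0 : ℝ) < 2) _).ne hTmgf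
  have hsub : {ω | u < ∑ l ∈ s₁, E l ω} ∩ {ω | u < ∑ l ∈ s₂, E l ω} ⊆ {ω | u < S ω + T ω} := by
    rintro ω ⟨hω1 : u < ∑ l ∈ s₁, E l ω, hω2 : u < ∑ l ∈ s₂, E l ω⟩
    have e1 := Finset.sum_inter_add_sum_sdiff s₁ s₂ fun l => E l ω
    have e2 := Finset.sum_inter_add_sum_sdiff s₂ s₁ fun l => E l ω
    rw [Finset.inter_comm] at e2
    have e3 : ∑ l ∈ D, E l ω = ∑ l ∈ s₁ \ s₂, E l ω + ∑ l ∈ s₂ \ s₁, E l ω :=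
      Finset.sum_union hdisj
    show u < ∑ l ∈ I, E l ω + 1 / 2 * ∑ l ∈ D, E l ω
    rw [e3]
    linarith
  refine (measureReal_mono hsub).trans ((measureReal_lt_add_le_of_gamma (hmeas I)
    ((hmeas D).const_mul _) hST hIpos (map_sum_exponential hE hind hmgf hinter)
    (fun ω => mul_nonneg (by norm_num) (Finset.sum_nonneg fun l _ => hE0 l ω)) hTint hu).trans ?_)
  rw [hTmgf]
  have hI1 : (I.card : ℝ) ≤ N := by exact_mod_cast (by omega : I.card ≤ N)
  -- Distinct windows share at most `N - 1` columns; this is where one power of `u` is gained.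
  have hI2 : u ^ (I.card - 1) ≤ u ^ (N - 2) := pow_le_pow_right₀ hu (by omega)
  have hD2 : (2 : ℝ) ^ D.card ≤ 4 ^ N := by
    calc (2 : ℝ) ^ D.card ≤ 2 ^ (2 * N) := pow_le_pow_right₀ (by norm_num) (by omega)
      _ = 4 ^ N := by rw [pow_mul]; norm_num
  have hu0 : (0 : ℝ) ≤ u := by linarith
  calc (I.card : ℝ) * u ^ (I.card - 1) * Real.exp (-u) * 2 ^ D.card
      ≤ N * u ^ (N - 2) * Real.exp (-u) * 4 ^ N := by gcongr
    _ = _ := by ring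

end ExponentialSums

/-! Window energies -/

/-- The columns of the virtual channel covered by the array at location `m`. -/
def windowSupport (N L m : ℕ) : Finset (Fin L) :=
  Finset.univ.filter fun l => m ≤ l.1 ∧ l.1 < m + N

theorem mem_windowSupport {N L m : ℕ} {l : Fin L} :
    l ∈ windowSupport N L m ↔ m ≤ l.1 ∧ l.1 < m + N := by
  simp [windowSupport]

/-- The inclusion of the columns of the array at location `m` into the virtual channel. -/
def windowEmbedding {N L m : ℕ} (hm : m + N ≤ L) : Fin N ↪ Fin L where
  toFun j := ⟨m + j.1, by have := j.2; omega⟩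
  inj' i j hij := Fin.ext (by have := Fin.ext_iff.1 hij; dsimp only at this; omega)

theorem windowSupport_eq_map {N L m : ℕ} (hm : m + N ≤ L) :
    windowSupport N L m = Finset.univ.map (windowEmbedding hm) := by
  ext l
  simp only [mem_windowSupport, Finset.mem_map, Finset.mem_univ, true_and,
    Fin.ext_iff]
  constructor
  · rintro ⟨h1, h2⟩
    exact ⟨⟨l.1 - m, by omega⟩, show m + (l.1 - m) = l.1 by omega⟩
  · rintro ⟨j, hj : m + j.1 = l.1⟩
    have := j.2
    omega

theorem card_windowSupport {N L m : ℕ} (hm : m + N ≤ L) : (windowSupport N L m).card = N := by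
  rw [windowSupport_eq_map hm, Finset.card_map, Finset.card_univ, Fintype.card_fin]

theorem windowEnergy_eq_sum {N L : ℕ} (hNL : N ≤ L) (g : Fin L → ℂ) (m : Fin (L - N + 1)) :
    windowEnergy hNL g m = ∑ l ∈ windowSupport N L m.1, ‖g l‖ ^ 2 := by
  have hm : m.1 + N ≤ L := by have := m.2; omega
  rw [windowSupport_eq_map hm, Finset.sum_map, windowEnergy, EuclideanSpace.norm_sq_eq]
  rfl

theorem maxWindowEnergy_le_iff {N L : ℕ} (hNL : N ≤ L) (g : Fin L → ℂ) (u : ℝ) :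
    maxWindowEnergy hNL g ≤ u ↔ ∀ m, windowEnergy hNL g m ≤ u := by
  simp [maxWindowEnergy]

theorem maxWindowEnergy_eq_of_isStrongestWindow {N L : ℕ} {hNL : N ≤ L} {g : Fin L → ℂ}
    {m : Fin (L - N + 1)} (h : IsStrongestWindow hNL g m) :
    ‖observedChannel hNL g m‖ ^ 2 = maxWindowEnergy hNL g :=
  le_antisymm (Finset.le_sup' (windowEnergy hNL g) (Finset.mem_univ m))
    ((maxWindowEnergy_le_iff hNL g _).2 h)

theorem maxWindowEnergy_nonneg {N L : ℕ} (hNL : N ≤ L) (g : Fin L → ℂ) :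
    0 ≤ maxWindowEnergy hNL g :=
  (sq_nonneg ‖observedChannel hNL g 0‖).trans
    (Finset.le_sup' (windowEnergy hNL g) (Finset.mem_univ 0))

theorem measurable_windowEnergy {N L : ℕ} (hNL : N ≤ L) (m : Fin (L - N + 1)) :
    Measurable fun g : Fin L → ℂ => windowEnergy hNL g m := by
  simp only [windowEnergy_eq_sum]
  fun_prop

theorem measurable_maxWindowEnergy {N L : ℕ} (hNL : N ≤ L) :
    Measurable fun g : Fin L → ℂ => maxWindowEnergy hNL g :=
  measurable_of_Iic fun u => by
    have : (fun g : Fin L → ℂ => maxWindowEnergy hNL g) ⁻¹' Set.Iic u =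
        ⋂ m, {g | windowEnergy hNL g m ≤ u} := by
      ext g; simp [maxWindowEnergy_le_iff]
    rw [this]
    exact MeasurableSet.iInter fun m => measurableSet_le (measurable_windowEnergy hNL m)
      measurable_const

section RayleighChannel

variable {Ω : Type*} [MeasurableSpace Ω] {P : Measure Ω} {N L : ℕ} {h : Fin L → Ω → ℂ}

theorem mgf_norm_sq_of_map_eq {X : Ω → ℂ} (hX : Measurable X)
    (hlaw : P.map X = stdComplexGaussian) (t : ℝ) :
    mgf (fun ω => ‖X ω‖ ^ 2) P t = if t < 1 then (1 - t)⁻¹ else 0 := by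
  rw [← mgf_norm_sq_stdComplexGaussian, ← hlaw, mgf_map hX.aemeasurable (by fun_prop)]
  rfl

theorem iIndepFun_norm_sq (h_indep : iIndepFun h P) : iIndepFun (fun l ω => ‖h l ω‖ ^ 2) P :=
  h_indep.comp (fun _ (z : ℂ) => ‖z‖ ^ 2) fun _ => by fun_prop

theorem map_windowEnergy (hN : 1 ≤ N) (hNL : N ≤ L) (h_meas : ∀ l, Measurable (h l))
    (h_law : ∀ l, P.map (h l) = stdComplexGaussian) (h_indep : iIndepFun h P)
    (m : Fin (L - N + 1)) :
    P.map (fun ω => windowEnergy hNL (fun l => h l ω) m) = gammaMeasure N 1 := by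
  have hcard := card_windowSupport (N := N) (L := L) (m := m.1) (by have := m.2; omega)
  simp only [windowEnergy_eq_sum]
  rw [map_sum_exponential (fun l => (h_meas l).norm.pow_const 2) (iIndepFun_norm_sq h_indep)
    (fun l t => mgf_norm_sq_of_map_eq (h_meas l) (h_law l) t)
    (Finset.card_pos.1 (by omega)), hcard]

/-- Functions of the channel that depend on disjoint sets of columns are independent. -/
theorem indepFun_of_disjoint_columns {α β : Type*} [MeasurableSpace α] [MeasurableSpace β]
    (h_meas : ∀ l, Measurable (h l)) (h_indep : iIndepFun h P) {s t : Finset (Fin L)}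
    (hst : Disjoint s t) {f : (s → ℂ) → α} {g : (t → ℂ) → β} (hf : Measurable f)
    (hg : Measurable g) :
    IndepFun (fun ω => f fun l => h l.1 ω) (fun ω => g fun l => h l.1 ω) P :=
  (h_indep.indepFun_finset s t hst h_meas).comp hf hg

/-- Windows at distance at least `N` share no column, so the two groups are functions of disjoint
families of independent entries. -/
theorem isMDependentSeq_windowEnergy (hNL : N ≤ L) (h_meas : ∀ l, Measurable (h l))
    (h_indep : iIndepFun h P) :
    IsMDependentSeq P N fun m ω => windowEnergy hNL (fun l => h l ω) m := by
  intro A B hAB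
  set s : Finset (Fin L) := A.biUnion fun i => windowSupport N L i.1 with hs
  set t : Finset (Fin L) := B.biUnion fun i => windowSupport N L i.1 with ht
  have hst : Disjoint s t := by
    rw [Finset.disjoint_left]
    intro l hl hl'
    simp only [hs, ht, Finset.mem_biUnion, mem_windowSupport] at hl hl'
    obtain ⟨i, hi, hi'⟩ := hl
    obtain ⟨j, hj, hj'⟩ := hl'
    have := hAB i hi j hj
    rw [le_abs] at this
    omega
  have key (C : Finset (Fin (L - N + 1))) (r : Finset (Fin L))
      (hr : r = C.biUnion fun i => windowSupport N L i.1) (ω : Ω) :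
      (fun i : C => windowEnergy hNL (fun l => h l ω) i.1) =
        (fun (x : r → ℂ) (i : C) => ∑ l : r, if l.1 ∈ windowSupport N L i.1.1 then ‖x l‖ ^ 2 else 0)
          fun l => h l.1 ω := by
    ext i
    simp only [windowEnergy_eq_sum]
    rw [Finset.sum_coe_sort r fun l => if l ∈ windowSupport N L i.1.1 then ‖h l ω‖ ^ 2 else 0,
      Finset.sum_ite_mem, Finset.inter_eq_right.2]
    rw [hr]
    exact Finset.subset_biUnion_of_mem (fun i : Fin (L - N + 1) => windowSupport N L i.1) i.2
  have hmeas (C : Finset (Fin (L - N + 1))) (r : Finset (Fin L)) :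
      Measurable (fun (x : r → ℂ) (i : C) =>
        ∑ l : r, if l.1 ∈ windowSupport N L i.1.1 then ‖x l‖ ^ 2 else 0) := by
    refine measurable_pi_lambda _ fun i => Finset.measurable_sum _ fun l _ => ?_
    split_ifs <;> fun_prop
  exact (indepFun_of_disjoint_columns h_meas h_indep hst (hmeas A s) (hmeas B t)).congr
    (ae_of_all _ fun ω => (key A s hs ω).symm) (ae_of_all _ fun ω => (key B t ht ω).symm)

/-- From any starting point, `k` consecutive energies are the same function `F` of `k + N - 1`
consecutive columns, whose joint law is always the same product. -/
theorem isStationarySeq_windowEnergy (hNL : N ≤ L) (h_meas : ∀ l, Measurable (h l))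
    (h_law : ∀ l, P.map (h l) = stdComplexGaussian) (h_indep : iIndepFun h P) :
    IsStationarySeq P fun m ω => windowEnergy hNL (fun l => h l ω) m := by
  intro k s hks
  rcases Nat.eq_zero_or_pos k with rfl | hk
  · congr 1
    ext ω i
    exact i.elim0
  have := h_indep.isProbabilityMeasure
  set F : (Fin (k + N - 1) → ℂ) → Fin k → ℝ := fun x i =>
    ∑ j : Fin N, ‖x ⟨i.1 + j.1, by have := i.2; have := j.2; omega⟩‖ ^ 2 with hF
  have hFmeas : Measurable F := by fun_prop
  have shift (r : ℕ) (hr : k + r ≤ L - N + 1) :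
      P.map (fun ω (i : Fin k) =>
        windowEnergy hNL (fun l => h l ω) ⟨i.1 + r, by have := i.2; omega⟩) =
      (Measure.pi fun _ : Fin (k + N - 1) => stdComplexGaussian).map F := by
    set e : Fin (k + N - 1) → Fin L := fun l => ⟨l.1 + r, by have := l.2; omega⟩ with he
    have hinj : Function.Injective e := fun a b hab => by
      simpa [he, Fin.ext_iff] using hab
    have hpi := (h_indep.precomp hinj).map_fun_eq_pi_map fun l => (h_meas (e l)).aemeasurable
    simp only [h_law] at hpi
    rw [← hpi, Measure.map_map hFmeas (by fun_prop)]
    congr 1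
    ext ω i
    simp only [windowEnergy, observedChannel, EuclideanSpace.norm_sq_eq, hF, Function.comp_apply, he]
    refine Finset.sum_congr rfl fun j _ => ?_
    congr 4
    omega
  rw [shift s hks]
  exact (shift 0 (by omega)).symm

/-- Quantitative extremal law: the window energies stay below a level about as often as if they
were independent. -/
theorem abs_measureReal_maxWindowEnergy_le_sub_pow_le (hN : 1 ≤ N) (hNL : N ≤ L)
    (h_meas : ∀ l, Measurable (h l)) (h_law : ∀ l, P.map (h l) = stdComplexGaussian)
    (h_indep : iIndepFun h P) {u : ℝ} (hu : 1 ≤ u) :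
    |P.real {ω | maxWindowEnergy hNL (fun l => h l ω) ≤ u}
        - (1 - gammaTail N u) ^ (L - N + 1)| ≤
      ((L - N + 1 : ℕ) : ℝ) * (N * (gammaTail N u ^ 2 +
        (if N = 1 then 0 else N * 4 ^ N * (u ^ (N - 2) * Real.exp (-u))))) := by
  have := h_indep.isProbabilityMeasure
  have hu0 : (0 : ℝ) ≤ u := by linarith
  set E : Fin L → Ω → ℝ := fun l ω => ‖h l ω‖ ^ 2 with hEdef
  have hE : ∀ l, Measurable (E l) := fun l => (h_meas l).norm.pow_const 2
  set A : ℕ → Set Ω := fun m => {ω | u < ∑ l ∈ windowSupport N L m, E l ω} with hAdef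
  have hAmeas (m : ℕ) : MeasurableSet (A m) :=
    measurableSet_lt measurable_const (Finset.measurable_sum _ fun l _ => hE l)
  have hlaw_A (m : ℕ) (hm : m < L - N + 1) : P.real (A m) = gammaTail N u := by
    have hlaw := map_windowEnergy hN hNL h_meas h_law h_indep ⟨m, hm⟩
    simp only [windowEnergy_eq_sum] at hlaw
    rw [← gammaMeasure_real_Ioi hN hu0, ← hlaw,
      map_measureReal_apply (Finset.measurable_sum _ fun l _ => hE l) measurableSet_Ioi]
    rfl
  have hset : {ω | maxWindowEnergy hNL (fun l => h l ω) ≤ u} =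
      {ω | ∀ i < L - N + 1, ω ∉ A i} := by
    ext ω
    simp only [Set.mem_ofPred_eq, maxWindowEnergy_le_iff, windowEnergy_eq_sum, hAdef, not_lt]
    exact ⟨fun H i hi => H ⟨i, hi⟩, fun H m => H m.1 m.2⟩
  rw [hset]
  refine abs_measureReal_forall_notMem_sub_pow_le P (by split_ifs <;> positivity) hN
    (fun m _ => hAmeas m) hlaw_A (fun m hm => ?_) (fun m hm i hi hmi => ?_)
  · have hdep := isMDependentSeq_windowEnergy hNL h_meas h_indep {⟨m, hm⟩}
      (Finset.univ.filter fun i => i.1 + N ≤ m) (fun i hi j hj => by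
        rw [Finset.mem_singleton] at hi
        subst hi
        have := (Finset.mem_filter.1 hj).2
        rw [le_abs]
        left
        dsimp only
        omega)
    have hmul := hdep.measure_inter_preimage_eq_mul
      {x | u < x ⟨⟨m, hm⟩, Finset.mem_singleton_self _⟩} {x | ∀ j, x j ≤ u}
      (measurableSet_lt measurable_const (measurable_pi_apply _))
      (by
        rw [Set.ofPred_forall]
        exact MeasurableSet.iInter fun j => measurableSet_le (measurable_pi_apply j)
          measurable_const)
    have hC : {ω | ∀ i, i + N ≤ m → ω ∉ A i} =
        (fun ω (j : (Finset.univ.filter fun i : Fin (L - N + 1) => i.1 + N ≤ m)) =>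
          windowEnergy hNL (fun l => h l ω) j.1) ⁻¹' {x | ∀ j, x j ≤ u} := by
      ext ω
      simp only [Set.mem_preimage, Set.mem_ofPred_eq, windowEnergy_eq_sum, hAdef, not_lt]
      exact ⟨fun H j => H j.1.1 (Finset.mem_filter.1 j.2).2, fun H i hi =>
        H ⟨⟨i, by omega⟩, Finset.mem_filter.2 ⟨Finset.mem_univ _, hi⟩⟩⟩
    have hAm : A m = (fun ω (j : ({⟨m, hm⟩} : Finset (Fin (L - N + 1)))) =>
        windowEnergy hNL (fun l => h l ω) j.1) ⁻¹'
          {x | u < x ⟨⟨m, hm⟩, Finset.mem_singleton_self _⟩} := by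
      ext ω
      simp only [Set.mem_preimage, Set.mem_ofPred_eq, windowEnergy_eq_sum, hAdef]
      rfl
    rw [← hlaw_A m hm, hC, hAm, measureReal_def, hmul, ENNReal.toReal_mul]
    rfl
  -- For `N = 1` no index satisfies `i < m < i + N`, which justifies the value `0` of the joint
  -- bound there.
  · have hN1 : N ≠ 1 := by omega
    rw [if_neg hN1]
    refine measureReal_lt_sum_inter_lt_sum_le hE (fun l ω => sq_nonneg _)
      (iIndepFun_norm_sq h_indep)
      (fun l t => mgf_norm_sq_of_map_eq (h_meas l) (h_law l) t) (card_windowSupport (by omega))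
      (card_windowSupport (by omega)) ?_ ?_ hu
    · intro heq
      have : (⟨i, by omega⟩ : Fin L) ∈ windowSupport N L m :=
        heq ▸ mem_windowSupport.2 ⟨le_rfl, by simp; omega⟩
      have := (mem_windowSupport.1 this).1
      simp at this
      omega
    · exact ⟨⟨m, by omega⟩, Finset.mem_inter.2
        ⟨mem_windowSupport.2 (by simp; omega), mem_windowSupport.2 (by simp; omega)⟩⟩

end RayleighChannel

/-! Asymptotics of the normalizing sequences -/

/-- The indicator is redundant, as `N - 1` vanishes for one antenna; all asymptotics can thus treat
every `N` at once. -/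
theorem deltaInd_mul_sub_one (N : ℕ) : deltaInd N * ((N : ℝ) - 1) = (N : ℝ) - 1 := by
  rw [deltaInd]
  split_ifs with h
  · simp [h]
  · rw [one_mul]

theorem tendsto_log_natCast_atTop : Tendsto (fun L : ℕ => Real.log L) atTop atTop :=
  Real.tendsto_log_atTop.comp tendsto_natCast_atTop_atTop

section NormalizingSequences

variable (N : ℕ)

theorem tendsto_xiSeq_sub_log :
    Tendsto (fun L : ℕ => xiSeq N L - Real.log L) atTop
      (𝓝 (-Real.log ((N - 1).factorial : ℝ) + ((N : ℝ) - 1) * Real.log ((N : ℝ) - 1))) := by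
  have h1 : Tendsto (fun L : ℕ => 1 - ((N : ℝ) - 1) * (L : ℝ)⁻¹) atTop (𝓝 (1 - ((N : ℝ) - 1) * 0)) :=
    (tendsto_inv_atTop_nhds_zero_nat.const_mul _).const_sub 1
  rw [mul_zero, sub_zero] at h1
  have h2 := (h1.log one_ne_zero).add_const
    (-Real.log ((N - 1).factorial : ℝ) + ((N : ℝ) - 1) * Real.log ((N : ℝ) - 1))
  rw [Real.log_one, zero_add] at h2
  refine h2.congr' ?_
  filter_upwards [eventually_gt_atTop N] with L hL
  have hL0 : (0 : ℝ) < L := by exact_mod_cast (Nat.zero_le N).trans_lt hL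
  have hLN : (N : ℝ) < L := by exact_mod_cast hL
  have e1 : (L : ℝ) - N + 1 = L * (1 - ((N : ℝ) - 1) * (L : ℝ)⁻¹) := by field_simp; ring
  have e2 : (1 - ((N : ℝ) - 1) * (L : ℝ)⁻¹) ≠ 0 := by
    intro h0; rw [h0, mul_zero] at e1; linarith
  have e3 : ((N - 1).factorial : ℝ) ≠ 0 := by positivity
  rw [xiSeq, deltaInd_mul_sub_one, Real.log_div (by linarith) e3, e1, Real.log_mul hL0.ne' e2]
  ring

theorem tendsto_div_of_tendsto_sub {ι : Type*} {l : Filter ι} {f g : ι → ℝ} {c : ℝ}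
    (hg : Tendsto g l atTop) (h : Tendsto (fun i => f i - g i) l (𝓝 c)) :
    Tendsto (fun i => f i / g i) l (𝓝 1) := by
  have h1 := (h.div_atTop hg).add_const 1
  rw [zero_add] at h1
  refine h1.congr' ?_
  filter_upwards [hg.eventually_gt_atTop 0] with i hi
  field_simp
  ring

theorem tendsto_xiSeq_atTop : Tendsto (xiSeq N) atTop atTop := by
  have := (tendsto_xiSeq_sub_log N).add_atTop tendsto_log_natCast_atTop
  simpa using this

theorem tendsto_xiSeq_div_log : Tendsto (fun L : ℕ => xiSeq N L / Real.log L) atTop (𝓝 1) :=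
  tendsto_div_of_tendsto_sub tendsto_log_natCast_atTop (tendsto_xiSeq_sub_log N)

theorem tendsto_log_xiSeq_div_xiSeq :
    Tendsto (fun L => Real.log (xiSeq N L) / xiSeq N L) atTop (𝓝 0) :=
  (Real.isLittleO_log_id_atTop.tendsto_div_nhds_zero).comp (tendsto_xiSeq_atTop N)

/-- With `n = N - 1`, expanding gives `φ = n ln (ξ/n) + n/ξ + n² ln (ξ/n)/ξ`, and the last two terms
vanish. -/
theorem tendsto_phiSeq_sub :
    Tendsto (fun L => phiSeq N L -
      ((N : ℝ) - 1) * (Real.log (xiSeq N L) - Real.log ((N : ℝ) - 1))) atTop (𝓝 0) := by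
  set n : ℝ := (N : ℝ) - 1 with hn
  have h1 : Tendsto (fun L => n * (xiSeq N L)⁻¹ + n ^ 2 *
      (Real.log (xiSeq N L) / xiSeq N L - Real.log n * (xiSeq N L)⁻¹)) atTop
      (𝓝 (n * 0 + n ^ 2 * (0 - Real.log n * 0))) := by
    have hinv := (tendsto_xiSeq_atTop N).inv_tendsto_atTop
    exact (hinv.const_mul _).add
      (((tendsto_log_xiSeq_div_xiSeq N).sub (hinv.const_mul _)).const_mul _)
  simp only [mul_zero, sub_zero, add_zero] at h1
  refine h1.congr' ?_
  filter_upwards [(tendsto_xiSeq_atTop N).eventually_gt_atTop 0] with L hL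
  have e1 : n * Real.log (xiSeq N L / n) = n * (Real.log (xiSeq N L) - Real.log n) := by
    rcases eq_or_ne n 0 with h0 | h0
    · simp [h0]
    · rw [Real.log_div hL.ne' h0]
  have e2 : phiSeq N L = (xiSeq N L)⁻¹ * (n + (n + xiSeq N L) * (n * Real.log (xiSeq N L / n))) := by
    rw [phiSeq, ← mul_div_assoc, deltaInd_mul_sub_one, ← hn]
    rw [show (N : ℝ) + xiSeq N L - 1 = n + xiSeq N L by rw [hn]; ring]
    ring
  rw [e2, e1]
  field_simp
  ring

/-- The centring sequence `ξ_L + φ_L` is asymptotically the classical one. -/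
theorem tendsto_centring_sub :
    Tendsto (fun L : ℕ => xiSeq N L + phiSeq N L -
      Real.log (((L : ℝ) - N + 1) / ((N - 1).factorial : ℝ)) -
      ((N : ℝ) - 1) * Real.log (xiSeq N L)) atTop (𝓝 0) := by
  -- The term `n ln n` of `ξ_L` cancels the `-n ln n` in the expansion of `φ_L`.
  refine (tendsto_phiSeq_sub N).congr fun L => ?_
  conv_rhs => rw [add_sub_right_comm]; enter [1, 1, 1]; rw [xiSeq, deltaInd_mul_sub_one]
  ring

theorem tendsto_centring_div_xiSeq :
    Tendsto (fun L => (xiSeq N L + phiSeq N L) / xiSeq N L) atTop (𝓝 1) := by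
  have hξ := tendsto_xiSeq_atTop N
  have h1 := ((tendsto_phiSeq_sub N).div_atTop hξ).add
    (((tendsto_log_xiSeq_div_xiSeq N).sub
      (hξ.inv_tendsto_atTop.const_mul (Real.log ((N : ℝ) - 1)))).const_mul ((N : ℝ) - 1))
  have h2 := h1.const_add 1
  simp only [mul_zero, sub_zero, add_zero] at h2
  refine h2.congr' ?_
  filter_upwards [hξ.eventually_gt_atTop 0] with L hL
  simp only [Pi.inv_apply]
  field_simp
  ring

theorem tendsto_centring_atTop : Tendsto (fun L => xiSeq N L + phiSeq N L) atTop atTop := by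
  refine ((tendsto_centring_div_xiSeq N).pos_mul_atTop one_pos (tendsto_xiSeq_atTop N)).congr' ?_
  filter_upwards [(tendsto_xiSeq_atTop N).eventually_gt_atTop 0] with L hL
  rw [div_mul_cancel₀ _ hL.ne']

theorem tendsto_betaSeq : Tendsto (betaSeq N) atTop (𝓝 1) := by
  have hb := tendsto_centring_atTop N
  have hinv := hb.inv_tendsto_atTop
  have h1 : Tendsto (fun L => (1 + ((N : ℝ) - 1) * (xiSeq N L + phiSeq N L)⁻¹) /
      (1 - ((N : ℝ) - 1) * ((N : ℝ) - 2) * (xiSeq N L + phiSeq N L)⁻¹ ^ 2)) atTop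
      (𝓝 ((1 + ((N : ℝ) - 1) * 0) / (1 - ((N : ℝ) - 1) * ((N : ℝ) - 2) * 0 ^ 2))) :=
    ((hinv.const_mul _).const_add 1).div (((hinv.pow 2).const_mul _).const_sub 1) (by simp)
  rw [show ((1 + ((N : ℝ) - 1) * 0) / (1 - ((N : ℝ) - 1) * ((N : ℝ) - 2) * 0 ^ 2)) = 1 by
    norm_num] at h1
  refine h1.congr' ?_
  filter_upwards [hb.eventually_gt_atTop 0] with L hL
  rw [betaSeq, ← mul_div_mul_right _ _ (pow_ne_zero 2 hL.ne')]
  congr 1 <;> field_simp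

theorem tendsto_thetaSeq_sub_centring :
    Tendsto (fun L => thetaSeq N L - (xiSeq N L + phiSeq N L)) atTop
      (𝓝 Real.eulerMascheroniConstant) := by
  have := (tendsto_betaSeq N).const_mul Real.eulerMascheroniConstant
  rw [mul_one] at this
  exact this.congr fun L => by rw [thetaSeq]; ring

theorem tendsto_thetaSeq_div_log : Tendsto (fun L : ℕ => thetaSeq N L / Real.log L) atTop (𝓝 1) := by
  have h1 := tendsto_div_of_tendsto_sub (tendsto_centring_atTop N)
    (tendsto_thetaSeq_sub_centring N)
  have h2 := (h1.mul (tendsto_centring_div_xiSeq N)).mul (tendsto_xiSeq_div_log N)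
  simp only [mul_one] at h2
  refine h2.congr' ?_
  filter_upwards [(tendsto_centring_atTop N).eventually_gt_atTop 0,
    (tendsto_xiSeq_atTop N).eventually_gt_atTop 0] with L h1 h2
  field_simp

theorem tendsto_one_add_mul_thetaSeq_div_log (ρ : ℝ) :
    Tendsto (fun L : ℕ => (1 + ρ * thetaSeq N L) / Real.log L) atTop (𝓝 ρ) := by
  have h := ((tendsto_thetaSeq_div_log N).const_mul ρ).add
    (tendsto_log_natCast_atTop.inv_tendsto_atTop)
  rw [mul_one, add_zero] at h
  refine h.congr fun L => ?_
  simp only [Pi.inv_apply]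
  ring

theorem tendsto_one_add_mul_thetaSeq_atTop {ρ : ℝ} (hρ : 0 < ρ) :
    Tendsto (fun L => 1 + ρ * thetaSeq N L) atTop atTop := by
  refine ((tendsto_one_add_mul_thetaSeq_div_log N ρ).pos_mul_atTop hρ
    tendsto_log_natCast_atTop).congr' ?_
  filter_upwards [tendsto_log_natCast_atTop.eventually_gt_atTop 0] with L hL
  rw [div_mul_cancel₀ _ hL.ne']

/-! Tail of the Gamma law at levels close to the centring sequence -/

variable {N} {u : ℕ → ℝ} {x : ℝ}

theorem tendsto_level_atTop (hu : Tendsto (fun L => u L - (xiSeq N L + phiSeq N L)) atTop (𝓝 x)) :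
    Tendsto u atTop atTop := by
  simpa using hu.add_atTop (tendsto_centring_atTop N)

/-- The logarithm of the left side is `ln (M/(N-1)!) - u + (N-1) ln u`. Since `ln u = ln ξ + o(1)`,
the centring cancels all but `-x`. -/
theorem tendsto_mul_level_pow_mul_exp (hN : 1 ≤ N)
    (hu : Tendsto (fun L => u L - (xiSeq N L + phiSeq N L)) atTop (𝓝 x)) :
    Tendsto (fun L : ℕ => ((L : ℝ) - N + 1) *
      (Real.exp (-u L) * (u L ^ (N - 1) / ((N - 1).factorial : ℝ)))) atTop (𝓝 (Real.exp (-x))) := by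
  have hξ := tendsto_xiSeq_atTop N
  have hratio : Tendsto (fun L => u L / xiSeq N L) atTop (𝓝 1) := by
    have h1 := ((hu.div_atTop hξ).add (tendsto_centring_div_xiSeq N))
    rw [zero_add] at h1
    exact h1.congr fun L => by ring
  have hexp : Tendsto (fun L : ℕ => -(u L - (xiSeq N L + phiSeq N L)) -
      (xiSeq N L + phiSeq N L - Real.log (((L : ℝ) - N + 1) / ((N - 1).factorial : ℝ)) -
        ((N : ℝ) - 1) * Real.log (xiSeq N L)) +
      ((N : ℝ) - 1) * Real.log (u L / xiSeq N L)) atTop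
      (𝓝 (-x - 0 + ((N : ℝ) - 1) * Real.log 1)) :=
    (hu.neg.sub (tendsto_centring_sub N)).add ((hratio.log one_ne_zero).const_mul _)
  rw [Real.log_one, mul_zero, sub_zero, add_zero] at hexp
  refine ((Real.continuous_exp.tendsto _).comp hexp).congr' ?_
  filter_upwards [hξ.eventually_gt_atTop 0, (tendsto_level_atTop hu).eventually_gt_atTop 0,
    eventually_ge_atTop N] with L h1 h2 h3
  have hLN : (N : ℝ) ≤ L := by exact_mod_cast h3
  have hM : 0 < ((L : ℝ) - N + 1) / ((N - 1).factorial : ℝ) := by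
    have : (0 : ℝ) < (L : ℝ) - N + 1 := by linarith
    positivity
  have hn : ((N - 1 : ℕ) : ℝ) = (N : ℝ) - 1 := by push_cast [hN]; ring
  rw [Function.comp_apply, Real.log_div h2.ne' h1.ne']
  calc _ = Real.exp (Real.log (((L : ℝ) - N + 1) / ((N - 1).factorial : ℝ)) + -u L +
        ((N - 1 : ℕ) : ℝ) * Real.log (u L)) := by rw [hn]; congr 1; ring
    _ = _ := by
      rw [Real.exp_add, Real.exp_add, Real.exp_log hM, Real.exp_nat_mul, Real.exp_log h2]
      ring

/-- One missing power of `u → ∞` kills the limit. This disposes both of joint exceedances and of the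
lower terms of the Gamma tail. -/
theorem tendsto_mul_level_pow_sub_two_mul_exp (hN : 2 ≤ N)
    (hu : Tendsto (fun L => u L - (xiSeq N L + phiSeq N L)) atTop (𝓝 x)) :
    Tendsto (fun L : ℕ => ((L : ℝ) - N + 1) * (u L ^ (N - 2) * Real.exp (-u L))) atTop (𝓝 0) := by
  have h1 := ((tendsto_mul_level_pow_mul_exp (by omega) hu).div_atTop
    (tendsto_level_atTop hu)).const_mul ((N - 1).factorial : ℝ)
  rw [mul_zero] at h1
  refine h1.congr' ?_
  filter_upwards [(tendsto_level_atTop hu).eventually_gt_atTop 0] with L hL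
  have : (N - 1) = (N - 2) + 1 := by omega
  have hf : ((N - 1).factorial : ℝ) ≠ 0 := by positivity
  rw [this] at hf ⊢
  rw [pow_succ]
  field_simp

theorem tendsto_mul_gammaTail (hN : 1 ≤ N)
    (hu : Tendsto (fun L => u L - (xiSeq N L + phiSeq N L)) atTop (𝓝 x)) :
    Tendsto (fun L : ℕ => ((L : ℝ) - N + 1) * gammaTail N (u L)) atTop (𝓝 (Real.exp (-x))) := by
  have hmain := tendsto_mul_level_pow_mul_exp hN hu
  obtain ⟨k, rfl⟩ : ∃ k, N = k + 1 := ⟨N - 1, by omega⟩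
  have hrest : Tendsto (fun L : ℕ => ((L : ℝ) - (k + 1 : ℕ) + 1) * gammaTail k (u L)) atTop
      (𝓝 0) := by
    rcases Nat.eq_zero_or_pos k with rfl | hk
    · simp [gammaTail]
    · have h1 := (tendsto_mul_level_pow_sub_two_mul_exp (by omega) hu).const_mul (k : ℝ)
      rw [mul_zero] at h1
      refine squeeze_zero' ?_ ?_ h1
      · filter_upwards [(tendsto_level_atTop hu).eventually_ge_atTop 0,
          eventually_ge_atTop (k + 1)] with L h2 h3
        have : ((k + 1 : ℕ) : ℝ) ≤ L := by exact_mod_cast h3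
        have : 0 ≤ gammaTail k (u L) :=
          mul_nonneg (Real.exp_pos _).le (Finset.sum_nonneg fun i _ => by positivity)
        exact mul_nonneg (by linarith) this
      · filter_upwards [(tendsto_level_atTop hu).eventually_ge_atTop 1,
          eventually_ge_atTop (k + 1)] with L h2 h3
        have : ((k + 1 : ℕ) : ℝ) ≤ L := by exact_mod_cast h3
        refine (mul_le_mul_of_nonneg_left (gammaTail_le (zero_le_one.trans h2) le_rfl h2)
          (by linarith)).trans_eq ?_
        rw [show k + 1 - 2 = k - 1 by omega]
        ring
  have h2 := hmain.add hrest
  rw [add_zero] at h2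
  refine h2.congr fun L => ?_
  rw [gammaTail, gammaTail, Finset.sum_range_succ, Nat.add_sub_cancel]
  ring

theorem tendsto_gammaTail_level
    (hu : Tendsto (fun L => u L - (xiSeq N L + phiSeq N L)) atTop (𝓝 x)) :
    Tendsto (fun L => gammaTail N (u L)) atTop (𝓝 0) :=
  (tendsto_gammaTail_atTop N).comp (tendsto_level_atTop hu)

theorem tendsto_one_sub_gammaTail_pow (hN : 1 ≤ N)
    (hu : Tendsto (fun L => u L - (xiSeq N L + phiSeq N L)) atTop (𝓝 x)) :
    Tendsto (fun L : ℕ => (1 - gammaTail N (u L)) ^ (L - N + 1)) atTop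
      (𝓝 (Real.exp (-Real.exp (-x)))) := by
  -- Reindex by the number of windows `n = L - N + 1`, which is the exponent in `(1 + a_n / n)^n`.
  have hshift : Tendsto (fun n : ℕ => n + N - 1) atTop atTop :=
    tendsto_atTop_mono (fun n => by dsimp only [id]; omega) tendsto_id
  have h1 := ((tendsto_mul_gammaTail hN hu).comp hshift).neg
  have h2 : Tendsto (fun n : ℕ => (n : ℝ) * -gammaTail N (u (n + N - 1))) atTop
      (𝓝 (-Real.exp (-x))) := by
    refine h1.congr fun n => ?_
    have : ((n + N - 1 : ℕ) : ℝ) = n + N - 1 := by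
      rw [Nat.cast_sub (by omega)]; push_cast; ring
    rw [Function.comp_apply, this]
    ring
  have hback : Tendsto (fun L : ℕ => L - N + 1) atTop atTop :=
    tendsto_atTop_mono (fun L => Nat.le_succ _) (tendsto_sub_atTop_nat N)
  refine ((Real.tendsto_one_add_pow_exp_of_tendsto h2).comp hback).congr' ?_
  filter_upwards [eventually_ge_atTop N] with L hL
  rw [Function.comp_apply, show L - N + 1 + N - 1 = L by omega, ← sub_eq_add_neg]

theorem tendsto_extremal_error (hN : 1 ≤ N)
    (hu : Tendsto (fun L => u L - (xiSeq N L + phiSeq N L)) atTop (𝓝 x)) :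
    Tendsto (fun L : ℕ => ((L - N + 1 : ℕ) : ℝ) * (N * (gammaTail N (u L) ^ 2 +
      (if N = 1 then 0 else N * 4 ^ N * (u L ^ (N - 2) * Real.exp (-u L)))))) atTop (𝓝 0) := by
  have h1 : Tendsto (fun L : ℕ => ((L : ℝ) - N + 1) *
      (if N = 1 then 0 else N * 4 ^ N * (u L ^ (N - 2) * Real.exp (-u L)))) atTop (𝓝 0) := by
    split_ifs with h
    · simp
    · have := (tendsto_mul_level_pow_sub_two_mul_exp (by omega) hu).const_mul ((N : ℝ) * 4 ^ N)
      rw [mul_zero] at this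
      exact this.congr fun L => by ring
  have h2 := (((tendsto_mul_gammaTail hN hu).mul (tendsto_gammaTail_level hu)).add h1).const_mul
    (N : ℝ)
  rw [mul_zero, add_zero, mul_zero] at h2
  refine h2.congr' ?_
  filter_upwards [eventually_ge_atTop N] with L hL
  push_cast [hL]
  ring

end NormalizingSequences

/-! The scale sequence -/

section Scale

variable {N : ℕ} {ρ : ℝ} {σ : ℕ → ℝ}

/-- The slope of `log₂ (1 + ρ z)` at `Θ_L` is `ρ / ((1 + ρ Θ_L) ln 2)`, and `σ_L` is `β_L` times it
up to `O(1/ln² L)`. Multiplied by `1 + ρ Θ_L`, of order `ln L`, this error still vanishes. -/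
theorem tendsto_scale_mul (hρ : 0 < ρ)
    (hσ : (fun L => σ L - sigmaMain ρ N L) =O[atTop] fun L : ℕ => 1 / (Real.log L) ^ 2) :
    Tendsto (fun L => (1 + ρ * thetaSeq N L) / ρ * (Real.log 2 * σ L)) atTop (𝓝 1) := by
  have hlog := tendsto_log_natCast_atTop
  have h1 : Tendsto (fun L => (1 + ρ * thetaSeq N L) * (σ L - sigmaMain ρ N L)) atTop (𝓝 0) := by
    have hO : (fun L => (1 + ρ * thetaSeq N L) * (σ L - sigmaMain ρ N L)) =O[atTop]
        fun L : ℕ => (1 + ρ * thetaSeq N L) * (1 / (Real.log L) ^ 2) := (isBigO_refl _ _).mul hσ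
    refine hO.trans_tendsto ?_
    have := (tendsto_one_add_mul_thetaSeq_div_log N ρ).mul hlog.inv_tendsto_atTop
    rw [mul_zero] at this
    refine this.congr fun L => ?_
    simp only [Pi.inv_apply]
    ring
  have h2 := (h1.const_mul (Real.log 2 / ρ)).add (tendsto_betaSeq N)
  rw [mul_zero, zero_add] at h2
  refine h2.congr' ?_
  filter_upwards [(tendsto_one_add_mul_thetaSeq_atTop N hρ).eventually_gt_atTop 0] with L hL
  have hl2 : Real.log 2 ≠ 0 := (Real.log_pos one_lt_two).ne'
  rw [sigmaMain, Real.logb, Real.log_exp]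
  field_simp
  ring

theorem tendsto_scale_zero (hρ : 0 < ρ)
    (hσ : (fun L => σ L - sigmaMain ρ N L) =O[atTop] fun L : ℕ => 1 / (Real.log L) ^ 2) :
    Tendsto σ atTop (𝓝 0) := by
  have hl2 : Real.log 2 ≠ 0 := (Real.log_pos one_lt_two).ne'
  have h1 := ((tendsto_scale_mul hρ hσ).div_atTop
    (tendsto_one_add_mul_thetaSeq_atTop N hρ)).const_mul (ρ / Real.log 2)
  rw [mul_zero] at h1
  refine h1.congr' ?_
  filter_upwards [(tendsto_one_add_mul_thetaSeq_atTop N hρ).eventually_gt_atTop 0] with L hL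
  field_simp

theorem eventually_scale_pos (hρ : 0 < ρ)
    (hσ : (fun L => σ L - sigmaMain ρ N L) =O[atTop] fun L : ℕ => 1 / (Real.log L) ^ 2) :
    ∀ᶠ L in atTop, 0 < σ L := by
  filter_upwards [(tendsto_scale_mul hρ hσ).eventually_const_lt one_pos,
    (tendsto_one_add_mul_thetaSeq_atTop N hρ).eventually_gt_atTop 0] with L h1 h2
  have hl2 : 0 < Real.log 2 := Real.log_pos one_lt_two
  have h3 : 0 < (1 + ρ * thetaSeq N L) / ρ := by positivity
  exact pos_of_mul_pos_right (pos_of_mul_pos_right h1 h3.le) hl2.le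

/-- The window energy at which the mutual information equals `μ_L - γ σ_L + σ_L x`. -/
noncomputable def energyLevel (ρ : ℝ) (N : ℕ) (σ : ℕ → ℝ) (x : ℝ) (L : ℕ) : ℝ :=
  ((1 + ρ * thetaSeq N L) *
    Real.exp (Real.log 2 * σ L * (x - Real.eulerMascheroniConstant)) - 1) / ρ

/-- The level equals `Θ + D (e^s - 1)`, with `D s → x - γ` and `s → 0`. The `γ` contained in `Θ_L`
compensates the `-γ`. -/
theorem tendsto_energyLevel_sub_centring (hρ : 0 < ρ)
    (hσ : (fun L => σ L - sigmaMain ρ N L) =O[atTop] fun L : ℕ => 1 / (Real.log L) ^ 2) (x : ℝ) :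
    Tendsto (fun L => energyLevel ρ N σ x L - (xiSeq N L + phiSeq N L)) atTop (𝓝 x) := by
  set c : ℝ := x - Real.eulerMascheroniConstant with hc
  set s : ℕ → ℝ := fun L => Real.log 2 * σ L * c with hs
  set D : ℕ → ℝ := fun L => (1 + ρ * thetaSeq N L) / ρ with hD
  have hs0 : Tendsto s atTop (𝓝 0) := by
    have := ((tendsto_scale_zero hρ hσ).const_mul (Real.log 2)).mul_const c
    simpa using this
  have hDs : Tendsto (fun L => D L * s L) atTop (𝓝 c) := by
    have := (tendsto_scale_mul hρ hσ).mul_const c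
    rw [one_mul] at this
    exact this.congr fun L => by simp only [hD, hs]; ring
  have hrem : Tendsto (fun L => D L * (Real.exp (s L) - 1 - s L)) atTop (𝓝 0) := by
    have h1 := (hDs.mul hs0).abs
    rw [mul_zero, abs_zero] at h1
    refine squeeze_zero_norm' ?_ h1
    have : ∀ᶠ L in atTop, |s L| < 1 := by
      have := hs0.abs
      rw [abs_zero] at this
      exact this.eventually_lt_const one_pos
    filter_upwards [this] with L hL
    rw [Real.norm_eq_abs, abs_mul, mul_assoc, abs_mul, ← sq, abs_of_nonneg (sq_nonneg (s L))]
    gcongr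
    exact Real.abs_exp_sub_one_sub_id_le hL.le
  have h := (((tendsto_thetaSeq_sub_centring N).add hDs).add hrem)
  rw [add_zero, hc, add_sub_cancel] at h
  refine h.congr fun L => ?_
  simp only [energyLevel, hD, hs, hc]
  field_simp
  ring

/-- In terms of the window energy, the mutual information is below its `x`-quantile level exactly
when the energy is below `energyLevel`. -/
theorem logb_one_add_mul_normalized_le_iff (hρ : 0 < ρ) {L : ℕ} (hσ : 0 < σ L)
    (hθ : 0 < 1 + ρ * thetaSeq N L) {z : ℝ} (hz : 0 ≤ z) (x : ℝ) :
    (Real.logb 2 (1 + ρ * z) - (muSeq ρ N L - Real.eulerMascheroniConstant * σ L)) / σ L ≤ x ↔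
      z ≤ energyLevel ρ N σ x L := by
  have hl2 : 0 < Real.log 2 := Real.log_pos one_lt_two
  have hz1 : 0 < 1 + ρ * z := by positivity
  rw [div_le_iff₀ hσ, energyLevel, le_div_iff₀ hρ, muSeq]
  have e1 : z * ρ ≤ (1 + ρ * thetaSeq N L) *
      Real.exp (Real.log 2 * σ L * (x - Real.eulerMascheroniConstant)) - 1 ↔
      1 + ρ * z ≤ Real.exp (Real.log (1 + ρ * thetaSeq N L) +
        Real.log 2 * σ L * (x - Real.eulerMascheroniConstant)) := by
    rw [Real.exp_add, Real.exp_log hθ]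
    constructor <;> intro h <;> linarith
  rw [e1, ← Real.log_le_iff_le_exp hz1, Real.logb, Real.logb]
  have e2 : Real.log (1 + ρ * z) = Real.log 2 * (Real.log (1 + ρ * z) / Real.log 2) := by
    field_simp
  have e3 : Real.log (1 + ρ * thetaSeq N L) =
    Real.log 2 * (Real.log (1 + ρ * thetaSeq N L) / Real.log 2) := by field_simp
  conv_rhs => rw [e2, e3, mul_assoc, ← mul_add, mul_le_mul_iff_right₀ hl2]
  constructor <;> intro h <;> linarith

/-! ### Growth of the location parameter -/

theorem tendsto_logb_logb_atTop :
    Tendsto (fun L : ℕ => Real.logb 2 (Real.logb 2 L)) atTop atTop :=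
  (Real.tendsto_logb_atTop one_lt_two).comp
    ((Real.tendsto_logb_atTop one_lt_two).comp tendsto_natCast_atTop_atTop)

theorem isEquivalent_of_tendsto_sub {f g : ℕ → ℝ} {c : ℝ} (hg : Tendsto g atTop atTop)
    (h : Tendsto (fun L => f L - g L) atTop (𝓝 c)) : f ~[atTop] g :=
  (h.isBigO_one ℝ).trans_isLittleO
    (isLittleO_one_left_iff ℝ |>.2 (tendsto_norm_atTop_atTop.comp hg))

theorem tendsto_muSeq_sub (N : ℕ) (hρ : 0 < ρ) :
    Tendsto (fun L : ℕ => muSeq ρ N L - Real.logb 2 (Real.logb 2 L)) atTop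
      (𝓝 (Real.log (ρ * Real.log 2) / Real.log 2)) := by
  have hl2 : 0 < Real.log 2 := Real.log_pos one_lt_two
  have h1 := (((tendsto_one_add_mul_thetaSeq_div_log N ρ).mul_const (Real.log 2)).log
    (mul_pos hρ hl2).ne').div_const (Real.log 2)
  refine h1.congr' ?_
  filter_upwards [tendsto_log_natCast_atTop.eventually_gt_atTop 0,
    (tendsto_one_add_mul_thetaSeq_atTop N hρ).eventually_gt_atTop 0] with L h2 h3
  rw [muSeq, Real.logb, Real.logb, Real.logb, ← sub_div, ← Real.log_div h3.ne' (by positivity)]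
  congr 2
  field_simp

theorem isEquivalent_muSeq (N : ℕ) (hρ : 0 < ρ) :
    muSeq ρ N ~[atTop] fun L : ℕ => Real.logb 2 (Real.logb 2 L) :=
  isEquivalent_of_tendsto_sub tendsto_logb_logb_atTop (tendsto_muSeq_sub N hρ)

theorem isEquivalent_muSeq_sub_scale (hρ : 0 < ρ)
    (hσ : (fun L => σ L - sigmaMain ρ N L) =O[atTop] fun L : ℕ => 1 / (Real.log L) ^ 2) :
    (fun L => muSeq ρ N L - Real.eulerMascheroniConstant * σ L)
      ~[atTop] fun L : ℕ => Real.logb 2 (Real.logb 2 L) := by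
  have h := (tendsto_muSeq_sub N hρ).sub
    ((tendsto_scale_zero hρ hσ).const_mul Real.eulerMascheroniConstant)
  exact isEquivalent_of_tendsto_sub tendsto_logb_logb_atTop (h.congr fun L => by ring)

end Scale

/-! Convergence of the maximal window energy and of the mutual information -/

theorem tendsto_subtype_val_atTop (N : ℕ) :
    Tendsto (fun L : {L : ℕ // N ≤ L} => L.1) atTop atTop :=
  tendsto_atTop.2 fun b => (eventually_ge_atTop (⟨max N b, le_max_left N b⟩ : {L : ℕ // N ≤ L})).mono
    fun _ hL => (le_max_right N b).trans hL

/-- If the normalized variables `(X - (m - γ s)) / s` converge to the standard Gumbel law and the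
scales tend to zero, then `X - m` tends to zero in probability. -/
theorem tendsto_measure_abs_sub_of_gumbel {ι : Type*} {Ω : ι → Type*} [∀ i, MeasurableSpace (Ω i)]
    {P : (i : ι) → Measure (Ω i)} [∀ i, IsProbabilityMeasure (P i)] {l : Filter ι}
    {X : (i : ι) → Ω i → ℝ} (hX : ∀ i, Measurable (X i)) {m s : ι → ℝ} {c : ℝ}
    (hs : ∀ᶠ i in l, 0 < s i) (hs0 : Tendsto s l (𝓝 0))
    (h : ∀ x, Tendsto (fun i => (P i).real {ω | (X i ω - (m i - c * s i)) / s i ≤ x}) l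
      (𝓝 (Real.exp (-Real.exp (-x))))) {ε : ℝ} (hε : 0 < ε) :
    Tendsto (fun i => P i {ω | ε ≤ |X i ω - m i|}) l (𝓝 0) := by
  -- Once `s i` is small relative to `ε` and `K`, a deviation of size `ε` pushes the normalized
  -- variable to `-K` or below, or above `K`. The bound `K` is chosen afterwards from the Gumbel
  -- tails.
  have hbound (K : ℝ) : ∀ᶠ i in l, (P i).real {ω | ε ≤ |X i ω - m i|} ≤
      (P i).real {ω | (X i ω - (m i - c * s i)) / s i ≤ -K} +
        (1 - (P i).real {ω | (X i ω - (m i - c * s i)) / s i ≤ K}) := by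
    have h1 : ∀ᶠ i in l, (c + K) * s i ≤ ε := by
      have := hs0.const_mul (c + K)
      rw [mul_zero] at this
      exact this.eventually_le_const hε
    have h2 : ∀ᶠ i in l, (K - c) * s i < ε := by
      have := hs0.const_mul (K - c)
      rw [mul_zero] at this
      exact this.eventually_lt_const hε
    filter_upwards [h1, h2, hs] with i h1 h2 hsi
    have hmeas : MeasurableSet {ω | (X i ω - (m i - c * s i)) / s i ≤ K} :=
      measurableSet_le (((hX i).sub_const _).div_const _) measurable_const
    rw [← probReal_compl_eq_one_sub hmeas]
    refine (measureReal_mono fun ω hω => ?_).trans (measureReal_union_le _ _)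
    have hω' : ε ≤ |X i ω - m i| := hω
    rcases le_abs.1 hω' with h3 | h3
    · right
      show ¬ (X i ω - (m i - c * s i)) / s i ≤ K
      rw [div_le_iff₀ hsi]
      intro h4
      linarith
    · left
      show (X i ω - (m i - c * s i)) / s i ≤ -K
      rw [div_le_iff₀ hsi]
      linarith
  have hreal : Tendsto (fun i => (P i).real {ω | ε ≤ |X i ω - m i|}) l (𝓝 0) := by
    refine tendsto_order.2 ⟨fun a ha => Eventually.of_forall fun i =>
      ha.trans_le measureReal_nonneg, fun a ha => ?_⟩
    have hlim : Tendsto (fun K : ℝ => Real.exp (-Real.exp (-(-K))) +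
        (1 - Real.exp (-Real.exp (-K)))) atTop (𝓝 (0 + (1 - 1))) :=
      (stdGumbelCDF_atBot.comp tendsto_neg_atTop_atBot).add (stdGumbelCDF_atTop.const_sub 1)
    rw [sub_self, add_zero] at hlim
    obtain ⟨K, hK⟩ := (hlim.eventually_lt_const ha).exists
    filter_upwards [hbound K, ((h (-K)).add ((h K).const_sub 1)).eventually_lt_const hK]
      with i h1 h2
    exact h1.trans_lt h2
  have := ENNReal.tendsto_ofReal hreal
  simpa using this

section RayleighArray

variable {N : ℕ} {Ω : {L : ℕ // N ≤ L} → Type*} [∀ L, MeasurableSpace (Ω L)]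
  {P : (L : {L : ℕ // N ≤ L}) → Measure (Ω L)} [∀ L, IsProbabilityMeasure (P L)]
  {h : (L : {L : ℕ // N ≤ L}) → Fin L.1 → Ω L → ℂ}

/-- General levels are allowed so that the affine levels of the maximum and the nonlinear ones of
the mutual information are both covered. -/
theorem tendsto_measureReal_maxWindowEnergy_le (hN : 1 ≤ N) (h_meas : ∀ L l, Measurable (h L l))
    (h_law : ∀ L l, (P L).map (h L l) = stdComplexGaussian)
    (h_indep : ∀ L, iIndepFun (h L) (P L)) {u : ℕ → ℝ} {x : ℝ}
    (hu : Tendsto (fun L => u L - (xiSeq N L + phiSeq N L)) atTop (𝓝 x)) :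
    Tendsto (fun L : {L : ℕ // N ≤ L} =>
      (P L).real {ω | maxWindowEnergy L.2 (fun l => h L l ω) ≤ u L.1}) atTop
      (𝓝 (Real.exp (-Real.exp (-x)))) := by
  have hval := tendsto_subtype_val_atTop N
  have hdiff := squeeze_zero_norm' (f := fun L : {L : ℕ // N ≤ L} =>
      (P L).real {ω | maxWindowEnergy L.2 (fun l => h L l ω) ≤ u L.1} -
        (1 - gammaTail N (u L.1)) ^ (L.1 - N + 1)) (by
      filter_upwards [hval.eventually ((tendsto_level_atTop hu).eventually_ge_atTop 1)] with L hL
      exact abs_measureReal_maxWindowEnergy_le_sub_pow_le hN L.2 (h_meas L) (h_law L) (h_indep L) hL)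
    ((tendsto_extremal_error hN hu).comp hval)
  have := hdiff.add ((tendsto_one_sub_gammaTail_pow hN hu).comp hval)
  rw [zero_add] at this
  exact this.congr fun L => by simp

theorem measurable_maxWindowEnergy_comp (h_meas : ∀ L l, Measurable (h L l))
    (L : {L : ℕ // N ≤ L}) : Measurable fun ω => maxWindowEnergy L.2 (fun l => h L l ω) :=
  (measurable_maxWindowEnergy L.2).comp (measurable_pi_lambda _ fun l => h_meas L l)

theorem tendstoInDistribution_maxWindowEnergy (hN : 1 ≤ N) (h_meas : ∀ L l, Measurable (h L l))
    (h_law : ∀ L l, (P L).map (h L l) = stdComplexGaussian)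
    (h_indep : ∀ L, iIndepFun (h L) (P L)) :
    TendstoInDistribution
      (fun L ω => (maxWindowEnergy L.2 (fun l => h L l ω) - (xiSeq N L.1 + phiSeq N L.1))
        / betaSeq N L.1)
      atTop (fun z : ℝ => z) P (gumbelMeasure 0 1) := by
  refine tendstoInDistribution_gumbel
    (fun L => ((measurable_maxWindowEnergy_comp h_meas L).sub_const _).div_const _) fun x => ?_
  have hu : Tendsto (fun L => (xiSeq N L + phiSeq N L + betaSeq N L * x) -
      (xiSeq N L + phiSeq N L)) atTop (𝓝 x) := by
    have := (tendsto_betaSeq N).mul_const x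
    rw [one_mul] at this
    exact this.congr fun L => by ring
  refine (tendsto_measureReal_maxWindowEnergy_le hN h_meas h_law h_indep hu).congr' ?_
  filter_upwards [(tendsto_subtype_val_atTop N).eventually
    ((tendsto_betaSeq N).eventually_const_lt one_pos)] with L hL
  congr 1
  ext ω
  simp only [Set.mem_ofPred_eq]
  rw [div_le_iff₀ hL, sub_le_iff_le_add', mul_comm x]

variable {ρ : ℝ} {mStar : (L : {L : ℕ // N ≤ L}) → Ω L → Fin (L.1 - N + 1)}

theorem mutualInformation_mStar
    (h_mStar : ∀ L ω, IsStrongestWindow L.2 (fun l => h L l ω) (mStar L ω))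
    (L : {L : ℕ // N ≤ L}) (ω : Ω L) :
    mutualInformation ρ L.2 (fun l => h L l ω) (mStar L ω) =
      Real.logb 2 (1 + ρ * maxWindowEnergy L.2 (fun l => h L l ω)) := by
  rw [mutualInformation, maxWindowEnergy_eq_of_isStrongestWindow (h_mStar L ω)]

/-- The selected location need not depend measurably on the outcome: only the maximal energy enters,
whatever the tie-breaking. -/
theorem measurable_mutualInformation_mStar (h_meas : ∀ L l, Measurable (h L l))
    (h_mStar : ∀ L ω, IsStrongestWindow L.2 (fun l => h L l ω) (mStar L ω))
    (L : {L : ℕ // N ≤ L}) :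
    Measurable fun ω => mutualInformation ρ L.2 (fun l => h L l ω) (mStar L ω) := by
  simp only [mutualInformation_mStar h_mStar, Real.logb]
  have := measurable_maxWindowEnergy_comp h_meas L
  fun_prop

theorem tendsto_measureReal_mutualInformation_le (hN : 1 ≤ N) (hρ : 0 < ρ)
    (h_meas : ∀ L l, Measurable (h L l))
    (h_law : ∀ L l, (P L).map (h L l) = stdComplexGaussian)
    (h_indep : ∀ L, iIndepFun (h L) (P L))
    (h_mStar : ∀ L ω, IsStrongestWindow L.2 (fun l => h L l ω) (mStar L ω)) {σ : ℕ → ℝ}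
    (hσ : (fun L => σ L - sigmaMain ρ N L) =O[atTop] fun L : ℕ => 1 / (Real.log L) ^ 2) (x : ℝ) :
    Tendsto (fun L => (P L).real {ω | (mutualInformation ρ L.2 (fun l => h L l ω) (mStar L ω)
        - (muSeq ρ N L.1 - Real.eulerMascheroniConstant * σ L.1)) / σ L.1 ≤ x}) atTop
      (𝓝 (Real.exp (-Real.exp (-x)))) := by
  refine (tendsto_measureReal_maxWindowEnergy_le hN h_meas h_law h_indep
    (tendsto_energyLevel_sub_centring hρ hσ x)).congr' ?_
  filter_upwards [(tendsto_subtype_val_atTop N).eventually (eventually_scale_pos hρ hσ),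
    (tendsto_subtype_val_atTop N).eventually
      ((tendsto_one_add_mul_thetaSeq_atTop N hρ).eventually_gt_atTop 0)] with L h1 h2
  congr 1
  ext ω
  simp only [Set.mem_ofPred_eq]
  rw [mutualInformation_mStar h_mStar,
    logb_one_add_mul_normalized_le_iff hρ h1 h2 (maxWindowEnergy_nonneg L.2 _)]

end RayleighArray

theorem theorem1 (N : ℕ) (hN : 1 ≤ N) (ρ : ℝ) (hρ : 0 < ρ)
    -- for each length `L ≥ N`, an i.i.d. Rayleigh virtual channel `h L` of length `L`
    {Ω : {L : ℕ // N ≤ L} → Type*} [∀ L, MeasurableSpace (Ω L)]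
    (P : (L : {L : ℕ // N ≤ L}) → Measure (Ω L)) [∀ L, IsProbabilityMeasure (P L)]
    (h : (L : {L : ℕ // N ≤ L}) → Fin L.1 → Ω L → ℂ)
    (h_meas : ∀ L l, Measurable (h L l))
    (h_law : ∀ L l, (P L).map (h L l) = stdComplexGaussian)
    (h_indep : ∀ L, iIndepFun (h L) (P L))
    -- the array is placed at a location of largest energy
    (mStar : (L : {L : ℕ // N ≤ L}) → Ω L → Fin (L.1 - N + 1))
    (h_mStar : ∀ L ω, IsStrongestWindow L.2 (fun l => h L l ω) (mStar L ω)) :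
    -- the window energies: Gamma(N, 1), stationary, `N`-dependent
    (∀ L, (∀ m, (P L).map (fun ω => windowEnergy L.2 (fun l => h L l ω) m) = gammaMeasure N 1) ∧
      IsStationarySeq (P L) (fun m ω => windowEnergy L.2 (fun l => h L l ω) m) ∧
      IsMDependentSeq (P L) N (fun m ω => windowEnergy L.2 (fun l => h L l ω) m)) ∧
    -- their normalized maximum converges in distribution to the standard Gumbel law
    TendstoInDistribution
      (fun L ω => (maxWindowEnergy L.2 (fun l => h L l ω) - (xiSeq N L.1 + phiSeq N L.1))
        / betaSeq N L.1)
      atTop (fun z : ℝ => z) P (gumbelMeasure 0 1) ∧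
    -- the mutual information, for every scale sequence with the prescribed expansion
    (∀ σ : ℕ → ℝ,
      ((fun L => σ L - sigmaMain ρ N L) =O[atTop] fun L : ℕ => 1 / (Real.log L) ^ 2) →
      (∀ᶠ L in atTop, 0 < σ L) ∧
      TendstoInDistribution
        (fun L ω => (mutualInformation ρ L.2 (fun l => h L l ω) (mStar L ω)
          - (muSeq ρ N L.1 - Real.eulerMascheroniConstant * σ L.1)) / σ L.1)
        atTop (fun z : ℝ => z) P (gumbelMeasure 0 1) ∧
      Tendsto
        (fun L : {L : ℕ // N ≤ L} => ⨆ x : ℝ,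
          |cdf ((P L).map fun ω => mutualInformation ρ L.2 (fun l => h L l ω) (mStar L ω)) x
            - cdf (gumbelMeasure (muSeq ρ N L.1 - Real.eulerMascheroniConstant * σ L.1)
                (σ L.1)) x|)
        atTop (𝓝 0) ∧
      -- hardening: location of order `log log L`, scale tending to zero
      ((fun L => muSeq ρ N L - Real.eulerMascheroniConstant * σ L)
        ~[atTop] fun L : ℕ => Real.logb 2 (Real.logb 2 L)) ∧
      Tendsto σ atTop (𝓝 0)) ∧
    (muSeq ρ N ~[atTop] fun L : ℕ => Real.logb 2 (Real.logb 2 L)) ∧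
    (∀ ε : ℝ, 0 < ε → Tendsto
      (fun L : {L : ℕ // N ≤ L} => P L
        {ω | ε ≤ |mutualInformation ρ L.2 (fun l => h L l ω) (mStar L ω) - muSeq ρ N L.1|})
      atTop (𝓝 0)) := by
  have hcdf := fun (σ : ℕ → ℝ) hσ =>
    tendsto_measureReal_mutualInformation_le (σ := σ) hN hρ h_meas h_law h_indep h_mStar hσ
  have hI_meas := measurable_mutualInformation_mStar (ρ := ρ) h_meas h_mStar
  have hval := tendsto_subtype_val_atTop N
  refine ⟨fun L => ⟨map_windowEnergy hN L.2 (h_meas L) (h_law L) (h_indep L),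
      isStationarySeq_windowEnergy L.2 (h_meas L) (h_law L) (h_indep L),
      isMDependentSeq_windowEnergy L.2 (h_meas L) (h_indep L)⟩,
    tendstoInDistribution_maxWindowEnergy hN h_meas h_law h_indep,
    fun σ hσ => ⟨eventually_scale_pos hρ hσ, ?_, ?_, isEquivalent_muSeq_sub_scale hρ hσ,
      tendsto_scale_zero hρ hσ⟩, isEquivalent_muSeq N hρ, fun ε hε => ?_⟩
  · exact tendstoInDistribution_gumbel (fun L => ((hI_meas L).sub_const _).div_const _) (hcdf σ hσ)
  · exact tendsto_iSup_abs_cdf_sub_gumbel hI_meas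
      (hval.eventually (eventually_scale_pos hρ hσ)) (hcdf σ hσ)
  -- Hardening around `μ_L` mentions no scale, so the leading term itself serves as the scale
  -- sequence.
  · have hσ : (fun L => sigmaMain ρ N L - sigmaMain ρ N L) =O[atTop]
        fun L : ℕ => 1 / (Real.log L) ^ 2 := by
      simpa using isBigO_zero _ _
    exact tendsto_measure_abs_sub_of_gumbel hI_meas
      (hval.eventually (eventually_scale_pos hρ hσ)) ((tendsto_scale_zero hρ hσ).comp hval)
      (hcdf _ hσ) hε
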